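/- Let $X$ be a finite or countable set and let $k:X\times X\to\mathbb R$ satisfy $k(x,y)\ge 0$ for $x\ne y$, $M_1(x):=\sum_{y\neq x}k(x,y)<\infty$, $k(x,x)=-M_1(x)$ and $M_2(x):=\sum_{y\ne x}k(x,y)\sum_{z\neq y}k(y,z)<\infty$ for all $x\in X$. Assume that the continuous-time Markov chain $(Z_t)_{t\ge0}$ on $X$ with transition rates $k$ is irreducible and non-explosive, and that it is reversible with respect to a probability measure $\mu$ with density $\pi:X\to(0,\infty)$, i.e. $\sum_x\pi(x)=1$ and $\pi(x)k(x,y)=\pi(y)k(y,x)$ for all $x,y\in X$. Let $Lf(x)=\sum_{y}k(x,y)(f(y)-f(x))$ be its generator and $P_tf(x)=\mathbb E(f(Z_t)\,|\,Z_0=x)$ its semigroup, so that $P_t1=1$. With $\Upsilon(r)=e^r-1-r$ put $$\Psi_\Upsilon(f)(x)=\sum_{y}k(x,y)\Upsilon(f(y)-f(x)),\qquad B_{\Upsilon'}(f,g)(x)=\sum_{y}k(x,y)\Upsilon'(f(y)-f(x))(g(y)-g(x)),$$ $$\Psi_{2,\Upsilon}(f)=\tfrac12\big(L\Psi_\Upsilon(f)-B_{\Upsilon'}(f,Lf)\big).$$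 Let $\mathcal P_*(X)$ be the set of $f:X\to(0,\infty)$ with $\sum_x f(x)\pi(x)=1$, and let $\mathcal P_*^+(X)$ be the set of those $f\in\mathcal P_*(X)$ that are bounded and bounded away from $0$. For $f\in\mathcal P_*(X)$ let $$\mathcal H(f)=\sum_x f(x)\log f(x)\,\pi(x)\in(-\infty,\infty],\qquad \mathcal I(f)=\tfrac12\sum_{x,y}k(x,y)(f(y)-f(x))(\log f(y)-\log f(x))\pi(x)\in[0,\infty];$$ for $f\in\mathcal P_*^+(X)$ one has $\mathcal I(f)=\sum_x f(x)\Psi_\Upsilon(\log f)(x)\pi(x)$. Suppose that $\sum_x M_1(x)^2\pi(x)<\infty$ and $\sum_x M_2(x)\pi(x)<\infty$, and that $L$ satisfies $CD_\Upsilon(\kappa,\infty)$ for some $\kappa>0$, that is, $\Psi_{2,\Upsilon}(f)(x)\ge\kappa\Psi_\Upsilon(f)(x)$ for all bounded $f:X\to\mathbb R$ and all $x\in X$. Then the modified logarithmic Sobolev inequality $$\mathcal H(f)\le\frac1{2\kappa}\,\mathcal I(f)\qquad\text{for all } f\in\mathcal P_*(X)\text{ with }\mathcal H(f)<\infty$$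 holds. In particular, $\mathcal H(P_tf)\le e^{-2\kappa t}\mathcal H(f)$ for all $f\in\mathcal P_*^+(X)$ and all $t\ge0$. -/

import Mathlib

open scoped ENNReal

namespace MarkovChainCD

variable {X : Type*}

/-! ### Rates, generator and the curvature-dimension condition

`k x y` are the entries of the rate matrix; its diagonal is minus the total exit rate. -/

open Classical in
/-- The jump rate from `x` to `y`: equal to `k x y` for `y ≠ x`, and `0` for `y = x`. -/
noncomputable def jumpRate (k : X → X → ℝ) (x y : X) : ℝ :=
  if y = x then 0 else k x y

/-- `M₁(x) = ∑_{y ≠ x} k(x,y)`. -/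
noncomputable def M₁ (k : X → X → ℝ) (x : X) : ℝ :=
  ∑' y, jumpRate k x y

/-- `M₂(x) = ∑_{y ≠ x} k(x,y) ∑_{z ≠ y} k(y,z)`. -/
noncomputable def M₂ (k : X → X → ℝ) (x : X) : ℝ :=
  ∑' y, jumpRate k x y * M₁ k y

/-- The generator `L f(x) = ∑_y k(x,y) (f(y) - f(x))`. -/
noncomputable def gen (k : X → X → ℝ) (f : X → ℝ) (x : X) : ℝ :=
  ∑' y, k x y * (f y - f x)

/-- `Ψ_H(f)(x) = ∑_y k(x,y) H(f(y) - f(x))`. -/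
noncomputable def Psi (k : X → X → ℝ) (H : ℝ → ℝ) (f : X → ℝ) (x : X) : ℝ :=
  ∑' y, k x y * H (f y - f x)

/-- `B_H(f,g)(x) = ∑_y k(x,y) H(f(y) - f(x)) (g(y) - g(x))`. -/
noncomputable def Bop (k : X → X → ℝ) (H : ℝ → ℝ) (f g : X → ℝ) (x : X) : ℝ :=
  ∑' y, k x y * H (f y - f x) * (g y - g x)

/-- `Υ(r) = e^r - 1 - r`. -/
noncomputable def upsilon (r : ℝ) : ℝ := Real.exp r - 1 - r

/-- `Ψ_{2,Υ}(f) = ½ (L Ψ_Υ(f) - B_{Υ'}(f, L f))`. -/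
noncomputable def Psi2 (k : X → X → ℝ) (f : X → ℝ) (x : X) : ℝ :=
  (1 / 2) * (gen k (Psi k upsilon f) x - Bop k (deriv upsilon) f (gen k f) x)

/-- The condition `CD_Υ(κ,∞)`: `Ψ_{2,Υ}(f) ≥ κ Ψ_Υ(f)` at every point, for every bounded `f`. -/
def CDUpsilon (k : X → X → ℝ) (κ : ℝ) : Prop :=
  ∀ f : X → ℝ, Memℓp f ∞ → ∀ x, κ * Psi k upsilon f x ≤ Psi2 k f x

/-! ### The Markov semigroup -/

open Classical in
/-- `transAux k n t x y` (for `t ≥ 0`) is the probability that the chain with jump rates `k`,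
started in `x`, is in `y` at time `t` and has made fewer than `n` jumps up to time `t`. The recursion
conditions on the first jump: either there is none up to time `t`, or it takes place at some time
`s ≤ t` and leads to some `z ≠ x`. -/
noncomputable def transAux (k : X → X → ℝ) : ℕ → ℝ → X → X → ℝ≥0∞
  | 0, _, _, _ => 0
  | n + 1, t, x, y =>
      (if y = x then ENNReal.ofReal (Real.exp (-(M₁ k x * t))) else 0) +
        ∫⁻ s in Set.Ioc 0 t, ENNReal.ofReal (Real.exp (-(M₁ k x * s))) *
          ∑' z, ENNReal.ofReal (jumpRate k x z) * transAux k n (t - s) z y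

/-- The transition function `p_t(x,y) = ℙ(Z_t = y | Z_0 = x)` (`t ≥ 0`) of the (minimal)
continuous-time Markov chain with rates `k`, that is the minimal nonnegative solution of the
Kolmogorov backward equation. -/
noncomputable def trans (k : X → X → ℝ) (t : ℝ) (x y : X) : ℝ≥0∞ :=
  ⨆ n, transAux k n t x y

/-- The semigroup `P_t f(x) = 𝔼(f(Z_t) | Z_0 = x) = ∑_y p_t(x,y) f(y)`, for `t ≥ 0` and bounded
`f`. -/
noncomputable def semigroup (k : X → X → ℝ) (t : ℝ) (f : X → ℝ) (x : X) : ℝ :=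
  ∑' y, (trans k t x y).toReal * f y

/-! ### The setting -/

/-- `k` is the rate matrix of an irreducible, non-explosive continuous-time Markov chain on `X` with
`M₁, M₂ < ∞` pointwise, and `π` is the (strictly positive) density with respect to the counting
measure of a reversible probability measure `μ`. -/
structure IsReversibleChain (k : X → X → ℝ) (π : X → ℝ) : Prop where
  rate_nonneg : ∀ x y, x ≠ y → 0 ≤ k x y
  M₁_finite : ∀ x, Summable (jumpRate k x)
  rate_diag : ∀ x, k x x = -M₁ k x
  M₂_finite : ∀ x, Summable fun y => jumpRate k x y * M₁ k y
  irreducible : ∀ x y, Relation.ReflTransGen (fun a b => 0 < k a b) x y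
  density_pos : ∀ x, 0 < π x
  density_sum : HasSum π 1
  detailed_balance : ∀ x y, π x * k x y = π y * k y x
  /-- stochastic completeness: `P_t 1 = 1` -/
  nonexplosive : ∀ t, 0 ≤ t → ∀ x, ∑' y, trans k t x y = 1

/-! ### Entropy, Fisher information and the modified logarithmic Sobolev inequality -/

/-- `𝒫_*(X)`: strictly positive probability densities with respect to `μ`. -/
def IsPosDensity (π : X → ℝ) (f : X → ℝ) : Prop :=
  (∀ x, 0 < f x) ∧ HasSum (fun x => f x * π x) 1

/-- `𝒫_*^+(X)`: probability densities that are bounded and bounded away from `0`. -/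
def IsPosBddDensity (π : X → ℝ) (f : X → ℝ) : Prop :=
  IsPosDensity π f ∧ Memℓp f ∞ ∧ ∃ c : ℝ, 0 < c ∧ ∀ x, c ≤ f x

open Classical in
/-- The entropy `ℋ(ρ) = ∑_x ρ(x) log(ρ(x)) π(x)` of a probability density `ρ`, a value in `(-∞,∞]`.
The negative part of the sum is at most `1/e` in absolute value, so that the sum is `+∞` exactly
when it does not converge absolutely. -/
noncomputable def entropy (π : X → ℝ) (ρ : X → ℝ) : EReal :=
  if Summable (fun x => ρ x * Real.log (ρ x) * π x) then
    ((∑' x, ρ x * Real.log (ρ x) * π x : ℝ) : EReal)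
  else ⊤

/-- The Fisher information
`ℐ(ρ) = ℰ(ρ, log ρ) = ½ ∑_{x,y} k(x,y) (ρ(y) - ρ(x)) (log ρ(y) - log ρ(x)) π(x)`
of a strictly positive density `ρ`, a value in `[0,∞]` (all terms are nonnegative). For `ρ` in
`𝒫_*^+(X)` it is `∑_x ρ(x) Ψ_Υ(log ρ)(x) π(x)`, see `fisher_eq_tsum_Psi`. -/
noncomputable def fisher (k : X → X → ℝ) (π : X → ℝ) (ρ : X → ℝ) : ℝ≥0∞ :=
  2⁻¹ * ∑' x, ∑' y,
    ENNReal.ofReal (k x y * (ρ y - ρ x) * (Real.log (ρ y) - Real.log (ρ x)) * π x)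

/-- `MLSI(α)`: `ℋ(f) ≤ (1/(2α)) ℐ(f)` for all `f ∈ 𝒫_*(X)` with `ℋ(f) < ∞`. -/
def MLSI (k : X → X → ℝ) (π : X → ℝ) (α : ℝ) : Prop :=
  ∀ f : X → ℝ, IsPosDensity π f → entropy π f < ⊤ →
    entropy π f ≤ ((1 / (2 * α) : ℝ) : EReal) * (fisher k π f : EReal)

theorem upsilon_nonneg (r : ℝ) : 0 ≤ upsilon r := by
  have := Real.add_one_le_exp r
  unfold upsilon; linarith

theorem deriv_upsilon (r : ℝ) : deriv upsilon r = Real.exp r - 1 := by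
  have h : HasDerivAt upsilon (Real.exp r - 1) r :=
    ((Real.hasDerivAt_exp r).sub_const 1).sub (hasDerivAt_id r)
  exact h.deriv

/-- On `𝒫_*^+(X)` the Fisher information is `∑_x ρ(x) Ψ_Υ(log ρ)(x) π(x)`. -/
theorem fisher_eq_tsum_Psi {k : X → X → ℝ} {π ρ : X → ℝ} (hk : IsReversibleChain k π)
    (hρ : IsPosBddDensity π ρ) :
    fisher k π ρ =
      ∑' x, ENNReal.ofReal (ρ x * Psi k upsilon (fun y => Real.log (ρ y)) x * π x) := by
  obtain ⟨⟨hpos, -⟩, hbdd, c, hc, hcρ⟩ := hρ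
  obtain ⟨C, hC⟩ := memℓp_infty_iff.1 hbdd
  have hCρ : ∀ x, ρ x ≤ C := fun x => (le_abs_self _).trans (hC ⟨x, rfl⟩)
  have hnn : ∀ x y, 0 ≤ k x y * upsilon (Real.log (ρ y) - Real.log (ρ x)) := by
    intro x y
    rcases eq_or_ne x y with rfl | h
    · simp [upsilon]
    · exact mul_nonneg (hk.rate_nonneg x y h) (upsilon_nonneg _)
  have hsum : ∀ x, Summable fun y => k x y * upsilon (Real.log (ρ y) - Real.log (ρ x)) := by
    intro x
    refine Summable.of_nonneg_of_le (hnn x) (fun y => ?_)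
      ((hk.M₁_finite x).mul_right (C / ρ x + |Real.log c| + |Real.log (ρ x)|))
    rcases eq_or_ne y x with rfl | h
    · simp [upsilon, jumpRate]
    · have h1 : Real.exp (Real.log (ρ y) - Real.log (ρ x)) ≤ C / ρ x := by
        rw [Real.exp_sub, Real.exp_log (hpos y), Real.exp_log (hpos x)]
        exact div_le_div_of_nonneg_right (hCρ y) (hpos x).le
      have h2 : Real.log c ≤ Real.log (ρ y) := Real.log_le_log hc (hcρ y)
      have h3 := neg_abs_le (Real.log c)
      have h4 := le_abs_self (Real.log (ρ x))
      simp only [jumpRate, h, if_false]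
      refine mul_le_mul_of_nonneg_left ?_ (hk.rate_nonneg x y h.symm)
      unfold upsilon; linarith
  let A : X → X → ℝ≥0∞ := fun x y =>
    ENNReal.ofReal (ρ x * (k x y * upsilon (Real.log (ρ y) - Real.log (ρ x))) * π x)
  have hA : ∀ x, ENNReal.ofReal (ρ x * Psi k upsilon (fun y => Real.log (ρ y)) x * π x)
      = ∑' y, A x y := by
    intro x
    rw [Psi, ← tsum_mul_left, ← tsum_mul_right]
    exact ENNReal.ofReal_tsum_of_nonneg
      (fun y => mul_nonneg (mul_nonneg (hpos x).le (hnn x y)) (hk.density_pos x).le)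
      (((hsum x).mul_left _).mul_right _)
  have hB : ∀ x y,
      ENNReal.ofReal (k x y * (ρ y - ρ x) * (Real.log (ρ y) - Real.log (ρ x)) * π x)
        = A x y + A y x := by
    intro x y
    rw [← ENNReal.ofReal_add
      (mul_nonneg (mul_nonneg (hpos x).le (hnn x y)) (hk.density_pos x).le)
      (mul_nonneg (mul_nonneg (hpos y).le (hnn y x)) (hk.density_pos y).le)]
    congr 1
    have hb : ∀ a b : ℝ, 0 < a → 0 < b → a * upsilon (Real.log b - Real.log a)
        = b - a - a * (Real.log b - Real.log a) := by
      intro a b ha hb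
      rw [upsilon, Real.exp_sub, Real.exp_log ha, Real.exp_log hb]
      field_simp
    have e1 := hb (ρ x) (ρ y) (hpos x) (hpos y)
    have e2 := hb (ρ y) (ρ x) (hpos y) (hpos x)
    have e3 := hk.detailed_balance x y
    linear_combination (-(π x * k x y)) * e1 - (π y * k y x) * e2
      + (ρ x - ρ y - ρ y * (Real.log (ρ x) - Real.log (ρ y))) * e3
  simp only [fisher, hA, hB]
  have : ∑' x, ∑' y, (A x y + A y x) = 2 * ∑' x, ∑' y, A x y := by
    simp only [ENNReal.tsum_add]
    rw [ENNReal.tsum_comm (f := fun x y => A y x), two_mul]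
  rw [this, ← mul_assoc, ENNReal.inv_mul_cancel (by norm_num) (by norm_num), one_mul]

end MarkovChainCD

namespace MarkovChainCD

open scoped ENNReal
open MeasureTheory Set Filter Topology

variable {X : Type*}

section Energy

/-! ### Edge weights and summation by parts -/

/-! This is the Bakry–Émery argument along the flow `u = P_t f`, for `f` with values in `[c, C]`, `c
> 0`. The entropy dissipates at the rate of the Fisher information `ℐ(u) = ½ energy(u, log u)`
(`hasDerivAt_tsum_mul_log`), and the derivative of `ℐ(u)` is `-2 ∑ u Ψ_{2,Υ}(log u) π`. Hence
`CD_Υ(κ,∞)`, tested with `log u` and integrated against `u π`, gives `ℐ(P_t f) ≤ e^{-2κt} ℐ(f)`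
(`energy_gen_add_le`, `energy_log_semigroup_le`).

The identity for the second derivative rests on `Ψ_Υ(log u) = Lu/u - L log u` (`Psi_upsilon_log`),
which replaces the chain rule of diffusions, and on summation by parts (`hasSum_mul_gen`). For
bounded `g` one only has `|Lg| ≤ const · M₁`, so terms such as `Lu · L log u` are of order `M₁²`;
this is where `∑ M₁² π < ∞` enters.

Decay of `ℐ` flattens `P_t f` across every edge; with irreducibility and conservation of mass, `P_t
f` tends to its mean (`tendsto_semigroup`). Integrating the dissipation over `[0,∞)` then bounds the
entropy by `ℐ(f)/(2κ)` (`tsum_mul_log_le_energy`). General densities are reached by truncation,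
which does not increase `ℐ`. Inserting the inequality back into the dissipation identity gives the
exponential decay of the entropy. -/

/-- The symmetric weight `π(x) k(x,y)` of an ordered pair `x ≠ y` (and `0` on the diagonal). -/
noncomputable def edgeWeight (k : X → X → ℝ) (π : X → ℝ) (p : X × X) : ℝ :=
  π p.1 * jumpRate k p.1 p.2

/-- The Dirichlet form summed over ordered pairs:
`∑_{x,y} π(x) k(x,y) (a(y) - a(x)) (b(y) - b(x))`. -/
noncomputable def energy (k : X → X → ℝ) (π : X → ℝ) (a b : X → ℝ) : ℝ :=
  ∑' p : X × X, edgeWeight k π p * ((a p.2 - a p.1) * (b p.2 - b p.1))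

theorem energy_comm (k : X → X → ℝ) (π a b : X → ℝ) : energy k π a b = energy k π b a := by
  simp only [energy, mul_comm (a _ - a _)]

/-- The diagonal rate is negative, but in all the operators it multiplies a quantity that vanishes
there, so the nonnegative off-diagonal rates may be used throughout. -/
theorem jumpRate_mul_of_diag (k : X → X → ℝ) (x y : X) {r : ℝ} (hr : y = x → r = 0) :
    k x y * r = jumpRate k x y * r := by
  unfold jumpRate
  split_ifs with h
  · simp [hr h]
  · rfl

theorem gen_eq_tsum_jumpRate (k : X → X → ℝ) (f : X → ℝ) (x : X) :
    gen k f x = ∑' y, jumpRate k x y * (f y - f x) :=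
  tsum_congr fun y => jumpRate_mul_of_diag k x y (by rintro rfl; simp)

namespace IsReversibleChain

variable {k : X → X → ℝ} {π : X → ℝ}

theorem jumpRate_nonneg (hk : IsReversibleChain k π) (x y : X) : 0 ≤ jumpRate k x y := by
  unfold jumpRate
  split_ifs with h
  · exact le_rfl
  · exact hk.rate_nonneg x y (Ne.symm h)

theorem M₁_nonneg (hk : IsReversibleChain k π) (x : X) : 0 ≤ M₁ k x :=
  tsum_nonneg (hk.jumpRate_nonneg x)

theorem edgeWeight_nonneg (hk : IsReversibleChain k π) (p : X × X) : 0 ≤ edgeWeight k π p :=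
  mul_nonneg (hk.density_pos _).le (hk.jumpRate_nonneg _ _)

theorem edgeWeight_swap (hk : IsReversibleChain k π) (p : X × X) :
    edgeWeight k π p.swap = edgeWeight k π p := by
  obtain ⟨x, y⟩ := p
  simp only [edgeWeight, jumpRate, Prod.fst_swap, Prod.snd_swap]
  by_cases h : x = y
  · simp [h]
  · simp [h, Ne.symm h, hk.detailed_balance y x]

theorem summable_M₁_mul (hk : IsReversibleChain k π)
    (hM₁ : Summable fun x => M₁ k x ^ 2 * π x) : Summable fun x => π x * M₁ k x := by
  refine Summable.of_nonneg_of_le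
    (fun x => mul_nonneg (hk.density_pos x).le (hk.M₁_nonneg x)) (fun x => ?_)
    (hk.density_sum.summable.add hM₁)
  -- `M₁ ≤ 1 + M₁²`, from `(M₁ - 1)² ≥ 0`.
  nlinarith [mul_nonneg (hk.density_pos x).le (sq_nonneg (M₁ k x - 1)),
    mul_nonneg (hk.density_pos x).le (hk.M₁_nonneg x)]

theorem summable_edgeWeight_mul_fst (hk : IsReversibleChain k π) {m : X → ℝ} (hm : ∀ x, 0 ≤ m x)
    (hs : Summable fun x => π x * M₁ k x * m x) :
    Summable fun p : X × X => edgeWeight k π p * m p.1 := by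
  have h0 : 0 ≤ fun p : X × X => edgeWeight k π p * m p.1 :=
    fun p => mul_nonneg (hk.edgeWeight_nonneg p) (hm _)
  refine (summable_prod_of_nonneg h0).2 ⟨fun x => ?_, ?_⟩
  · exact ((hk.M₁_finite x).mul_left (π x)).mul_right (m x)
  · refine hs.congr fun x => ?_
    simp only [edgeWeight]
    rw [tsum_mul_right, tsum_mul_left, M₁]

theorem summable_edgeWeight (hk : IsReversibleChain k π)
    (hM₁ : Summable fun x => M₁ k x ^ 2 * π x) : Summable (edgeWeight k π) := by
  simpa using hk.summable_edgeWeight_mul_fst (m := fun _ => 1) (fun _ => zero_le_one)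
    (by simpa using hk.summable_M₁_mul hM₁)

theorem summable_edgeWeight_mul_M₁_fst (hk : IsReversibleChain k π)
    (hM₁ : Summable fun x => M₁ k x ^ 2 * π x) :
    Summable fun p : X × X => edgeWeight k π p * M₁ k p.1 :=
  hk.summable_edgeWeight_mul_fst hk.M₁_nonneg (by convert hM₁ using 2; ring)

/-- Reversibility makes the weight invariant under swapping the pair, so a bound in the starting
point is also one in the end point. -/
theorem summable_edgeWeight_mul_M₁_snd (hk : IsReversibleChain k π)
    (hM₁ : Summable fun x => M₁ k x ^ 2 * π x) :
    Summable fun p : X × X => edgeWeight k π p * M₁ k p.2 := by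
  have := (Equiv.prodComm X X).summable_iff.2 (hk.summable_edgeWeight_mul_M₁_fst hM₁)
  convert this using 2 with p
  simp [hk.edgeWeight_swap]

/-- Summation by parts: `∑ π a L b = - ½ ∑ π(x) k(x,y) (a(y) - a(x)) (b(y) - b(x))`. -/
theorem hasSum_mul_gen (hk : IsReversibleChain k π) {a b : X → ℝ}
    (h₁ : Summable fun p : X × X => edgeWeight k π p * (a p.1 * b p.2))
    (h₂ : Summable fun p : X × X => edgeWeight k π p * (a p.1 * b p.1)) :
    HasSum (fun x => π x * (a x * gen k b x)) (-(1 / 2) * energy k π a b) := by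
  have S := h₁.sub h₂
  have h₁' := (Equiv.prodComm X X).summable_iff.2 h₁
  have h₂' := (Equiv.prodComm X X).summable_iff.2 h₂
  have e₁ := (Equiv.prodComm X X).tsum_eq fun p => edgeWeight k π p * (a p.1 * b p.2)
  have e₂ := (Equiv.prodComm X X).tsum_eq fun p => edgeWeight k π p * (a p.1 * b p.1)
  have hE : energy k π a b
      = (∑' p : X × X, edgeWeight k π p * (a p.1 * b p.1) -
          ∑' p : X × X, edgeWeight k π p * (a p.1 * b p.2)) * 2 := by
    -- Adding the swapped copies leaves the weight unchanged and produces the four terms of `(a(y) -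
    -- a(x)) (b(y) - b(x))`.
    have := ((h₂.hasSum.sub h₁.hasSum).add (h₂'.hasSum.sub h₁'.hasSum)).tsum_eq
    simp only [Function.comp_def] at this
    rw [e₁, e₂] at this
    rw [mul_two, ← this, energy]
    refine tsum_congr fun p => ?_
    simp only [Equiv.prodComm_apply, hk.edgeWeight_swap, Prod.fst_swap, Prod.snd_swap]
    ring
  have key := S.hasSum.prod_fiberwise fun x => (S.prod_factor x).hasSum
  rw [h₁.tsum_sub h₂] at key
  have hE' : ∑' p : X × X, edgeWeight k π p * (a p.1 * b p.2) -
      ∑' p : X × X, edgeWeight k π p * (a p.1 * b p.1) = -(1 / 2) * energy k π a b := by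
    rw [hE]; ring
  rw [hE'] at key
  refine (funext fun x => ?_ : (fun x => π x * (a x * gen k b x)) = _) ▸ key
  rw [gen_eq_tsum_jumpRate, ← tsum_mul_left, ← tsum_mul_left]
  refine tsum_congr fun y => ?_
  simp only [edgeWeight]
  ring

/-- Summation by parts for `|a| ≤ A M₁` and `|b| ≤ B`. -/
theorem hasSum_mul_gen_of_bounded_right (hk : IsReversibleChain k π)
    (hM₁ : Summable fun x => M₁ k x ^ 2 * π x) {a b : X → ℝ} {A B : ℝ}
    (ha : ∀ x, |a x| ≤ A * M₁ k x) (hb : ∀ x, |b x| ≤ B) :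
    HasSum (fun x => π x * (a x * gen k b x)) (-(1 / 2) * energy k π a b) := by
  have key : ∀ g : X × X → X, Summable fun p : X × X => edgeWeight k π p * (a p.1 * b (g p)) := by
    intro g
    refine Summable.of_norm_bounded
      ((hk.summable_edgeWeight_mul_M₁_fst hM₁).mul_right (A * B)) fun p => ?_
    rw [Real.norm_eq_abs, abs_mul, abs_of_nonneg (hk.edgeWeight_nonneg p), abs_mul, mul_assoc]
    refine mul_le_mul_of_nonneg_left ?_ (hk.edgeWeight_nonneg p)
    calc |a p.1| * |b (g p)| ≤ (A * M₁ k p.1) * B :=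
          mul_le_mul (ha _) (hb _) (abs_nonneg _) ((abs_nonneg _).trans (ha _))
      _ = _ := by ring
  exact hk.hasSum_mul_gen (key Prod.snd) (key Prod.fst)

/-- Summation by parts for `|a| ≤ A` and `|b| ≤ B M₁`. -/
theorem hasSum_mul_gen_of_bounded_left (hk : IsReversibleChain k π)
    (hM₁ : Summable fun x => M₁ k x ^ 2 * π x) {a b : X → ℝ} {A B : ℝ}
    (ha : ∀ x, |a x| ≤ A) (hb : ∀ x, |b x| ≤ B * M₁ k x) :
    HasSum (fun x => π x * (a x * gen k b x)) (-(1 / 2) * energy k π a b) := by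
  have key : ∀ g : X × X → X, (Summable fun p : X × X => edgeWeight k π p * M₁ k (g p)) →
      Summable fun p : X × X => edgeWeight k π p * (a p.1 * b (g p)) := by
    intro g hg
    refine Summable.of_norm_bounded (hg.mul_right (A * B)) fun p => ?_
    rw [Real.norm_eq_abs, abs_mul, abs_of_nonneg (hk.edgeWeight_nonneg p), abs_mul, mul_assoc]
    refine mul_le_mul_of_nonneg_left ?_ (hk.edgeWeight_nonneg p)
    calc |a p.1| * |b (g p)| ≤ A * (B * M₁ k (g p)) :=
          mul_le_mul (ha _) (hb _) (abs_nonneg _) ((abs_nonneg _).trans (ha p.1))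
      _ = _ := by ring
  exact hk.hasSum_mul_gen (key _ (hk.summable_edgeWeight_mul_M₁_snd hM₁))
    (key _ (hk.summable_edgeWeight_mul_M₁_fst hM₁))

/-- Summation by parts for bounded functions. -/
theorem hasSum_mul_gen_of_bounded (hk : IsReversibleChain k π)
    (hM₁ : Summable fun x => M₁ k x ^ 2 * π x) {a b : X → ℝ} {A B : ℝ}
    (ha : ∀ x, |a x| ≤ A) (hb : ∀ x, |b x| ≤ B) :
    HasSum (fun x => π x * (a x * gen k b x)) (-(1 / 2) * energy k π a b) := by
  have key : ∀ g : X × X → X,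
      Summable fun p : X × X => edgeWeight k π p * (a p.1 * b (g p)) := by
    intro g
    refine Summable.of_norm_bounded ((hk.summable_edgeWeight hM₁).mul_right (A * B)) fun p => ?_
    rw [Real.norm_eq_abs, abs_mul, abs_of_nonneg (hk.edgeWeight_nonneg p), abs_mul]
    exact mul_le_mul_of_nonneg_left
      (mul_le_mul (ha _) (hb _) (abs_nonneg _) ((abs_nonneg _).trans (ha p.1)))
      (hk.edgeWeight_nonneg p)
  exact hk.hasSum_mul_gen (key Prod.snd) (key Prod.fst)

/-! ### The generator on bounded functions. -/

theorem summable_jumpRate_mul (hk : IsReversibleChain k π) {f : X → ℝ} {C : ℝ}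
    (hf : ∀ x, |f x| ≤ C) (x : X) : Summable fun y => jumpRate k x y * f y := by
  refine Summable.of_norm_bounded ((hk.M₁_finite x).mul_right C) fun y => ?_
  rw [Real.norm_eq_abs, abs_mul, abs_of_nonneg (hk.jumpRate_nonneg x y)]
  exact mul_le_mul_of_nonneg_left (hf y) (hk.jumpRate_nonneg x y)

theorem gen_eq_sub (hk : IsReversibleChain k π) {f : X → ℝ} {C : ℝ} (hf : ∀ x, |f x| ≤ C)
    (x : X) : gen k f x = ∑' y, jumpRate k x y * f y - M₁ k x * f x := by
  rw [gen_eq_tsum_jumpRate, M₁, ← tsum_mul_right,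
    ← (hk.summable_jumpRate_mul hf x).tsum_sub ((hk.M₁_finite x).mul_right _)]
  exact tsum_congr fun y => by ring

theorem hasSum_gen (hk : IsReversibleChain k π) {f : X → ℝ} {C : ℝ} (hf : ∀ x, |f x| ≤ C)
    (x : X) : HasSum (fun y => jumpRate k x y * (f y - f x)) (gen k f x) := by
  rw [gen_eq_tsum_jumpRate]
  refine Summable.hasSum ?_
  simpa only [mul_sub] using (hk.summable_jumpRate_mul hf x).sub ((hk.M₁_finite x).mul_right (f x))

theorem abs_gen_le (hk : IsReversibleChain k π) {f : X → ℝ} {C : ℝ} (hf : ∀ x, |f x| ≤ C)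
    (x : X) : |gen k f x| ≤ 2 * C * M₁ k x := by
  rw [gen_eq_tsum_jumpRate, M₁, ← tsum_mul_left]
  rw [← Real.norm_eq_abs]
  refine tsum_of_norm_bounded ((hk.M₁_finite x).mul_left (2 * C)).hasSum fun y => ?_
  rw [Real.norm_eq_abs, abs_mul, abs_of_nonneg (hk.jumpRate_nonneg x y), mul_comm]
  refine mul_le_mul_of_nonneg_right ?_ (hk.jumpRate_nonneg x y)
  have := norm_sub_le (f y) (f x)
  simp only [Real.norm_eq_abs] at this
  linarith [hf x, hf y]

end IsReversibleChain
end Energy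

section Backward

/-! ### The backward equation -/

theorem ennreal_tsum_iSup_of_monotone {α : Type*} {f : ℕ → α → ℝ≥0∞}
    (hf : ∀ a, Monotone fun n => f n a) : ∑' a, ⨆ n, f n a = ⨆ n, ∑' a, f n a := by
  simp only [ENNReal.tsum_eq_iSup_sum]
  rw [iSup_comm]
  exact iSup_congr fun s => ENNReal.finsetSum_iSup_of_monotone hf

/-- The domain of integration moves with `t`; an indicator on the plane turns the claim into
measurability of a parameter integral. -/
theorem measurable_lintegral_Ioc_convolution {φ g : ℝ → ℝ≥0∞} (hφ : Measurable φ)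
    (hg : Measurable g) : Measurable fun t => ∫⁻ s in Ioc 0 t, φ s * g (t - s) := by
  have hS : MeasurableSet {p : ℝ × ℝ | 0 < p.2 ∧ p.2 ≤ p.1} :=
    (measurableSet_lt measurable_const measurable_snd).inter
      (measurableSet_le measurable_snd measurable_fst)
  have hF : Measurable (({p : ℝ × ℝ | 0 < p.2 ∧ p.2 ≤ p.1}).indicator
      fun p => φ p.2 * g (p.1 - p.2)) :=
    ((hφ.comp measurable_snd).mul (hg.comp (measurable_fst.sub measurable_snd))).indicator hS
  have := hF.lintegral_prod_right' (ν := volume)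
  convert this using 2 with t
  rw [← lintegral_indicator measurableSet_Ioc]
  rfl

theorem measurable_transAux [Countable X] (k : X → X → ℝ) (n : ℕ) (x y : X) :
    Measurable fun t => transAux k n t x y := by
  induction n generalizing x y with
  | zero => exact measurable_const
  | succ n ih =>
    simp only [transAux]
    refine Measurable.add ?_ ?_
    · split_ifs
      · fun_prop
      · exact measurable_const
    · exact measurable_lintegral_Ioc_convolution
        (φ := fun s => ENNReal.ofReal (Real.exp (-(M₁ k x * s))))
        (g := fun r => ∑' z, ENNReal.ofReal (jumpRate k x z) * transAux k n r z y)
        (by fun_prop) (Measurable.tsum fun z => (ih z y).const_mul _)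

theorem transAux_mono (k : X → X → ℝ) (t : ℝ) (x y : X) :
    Monotone fun n => transAux k n t x y := by
  refine monotone_nat_of_le_succ fun n => ?_
  induction n generalizing t x y with
  | zero => exact zero_le
  | succ n ih =>
    rw [transAux, transAux]
    gcongr
    exact ih _ _ _

theorem measurable_trans [Countable X] (k : X → X → ℝ) (x y : X) :
    Measurable fun t => trans k t x y :=
  Measurable.iSup fun n => measurable_transAux k n x y

open Classical in
/-- The integrated backward equation of the transition function. -/
theorem trans_eq [Countable X] (k : X → X → ℝ) (t : ℝ) (x y : X) :
    trans k t x y = (if y = x then ENNReal.ofReal (Real.exp (-(M₁ k x * t))) else 0) +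
      ∫⁻ s in Ioc 0 t, ENNReal.ofReal (Real.exp (-(M₁ k x * s))) *
        ∑' z, ENNReal.ofReal (jumpRate k x z) * trans k (t - s) z y := by
  -- Shifting the index of a monotone supremum exposes the recursion; the rest is monotone
  -- convergence for the sum and the integral.
  have h₁ : trans k t x y = ⨆ n, transAux k (n + 1) t x y :=
    ((transAux_mono k t x y).iSup_nat_add 1).symm
  rw [h₁]
  simp only [transAux]
  rw [← ENNReal.add_iSup]
  congr 1
  rw [← lintegral_iSup]
  · refine lintegral_congr fun s => ?_
    rw [← ENNReal.mul_iSup, ← ennreal_tsum_iSup_of_monotone]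
    · simp only [← ENNReal.mul_iSup, trans]
    · intro z m n hmn
      dsimp only
      gcongr
      exact transAux_mono k _ _ _ hmn
  · intro n
    refine Measurable.mul (by fun_prop) (Measurable.tsum fun z => ?_)
    exact ((measurable_transAux k n z y).comp (measurable_const.sub measurable_id)).const_mul _
  · intro m n hmn s
    dsimp only
    gcongr
    exact transAux_mono k _ _ _ hmn

/-- The semigroup acting on `[0,∞]`-valued functions. -/
noncomputable def esemigroup (k : X → X → ℝ) (t : ℝ) (F : X → ℝ≥0∞) (x : X) : ℝ≥0∞ :=
  ∑' y, trans k t x y * F y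

theorem measurable_esemigroup [Countable X] (k : X → X → ℝ) (F : X → ℝ≥0∞) (x : X) :
    Measurable fun t => esemigroup k t F x :=
  Measurable.tsum fun y => (measurable_trans k x y).mul_const _

/-- With values in `[0,∞]`, Tonelli exchanges all sums and integrals without any summability
condition. -/
theorem esemigroup_eq [Countable X] (k : X → X → ℝ) (t : ℝ) (F : X → ℝ≥0∞) (x : X) :
    esemigroup k t F x = ENNReal.ofReal (Real.exp (-(M₁ k x * t))) * F x +
      ∫⁻ s in Ioc 0 t, ENNReal.ofReal (Real.exp (-(M₁ k x * s))) *
        ∑' z, ENNReal.ofReal (jumpRate k x z) * esemigroup k (t - s) F z := by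
  classical
  have hm : ∀ y, Measurable fun s => ENNReal.ofReal (Real.exp (-(M₁ k x * s))) *
      ∑' z, ENNReal.ofReal (jumpRate k x z) * trans k (t - s) z y := fun y =>
    Measurable.mul (by fun_prop) (Measurable.tsum fun z =>
      ((measurable_trans k z y).comp (measurable_const.sub measurable_id)).const_mul _)
  rw [esemigroup]
  simp only [trans_eq k t x, add_mul]
  rw [ENNReal.tsum_add]
  congr 1
  · rw [tsum_eq_single x]
    · simp
    · intro y hy
      simp [hy]
  · simp only [← lintegral_mul_const _ (hm _)]
    rw [← lintegral_tsum fun y => ((hm y).mul_const _).aemeasurable]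
    refine lintegral_congr fun s => ?_
    simp only [mul_assoc, ENNReal.tsum_mul_left, esemigroup]
    congr 1
    simp only [← ENNReal.tsum_mul_left, ← ENNReal.tsum_mul_right]
    rw [ENNReal.tsum_comm]
    simp only [mul_assoc]

/-! ### Bounds and the backward equation for real-valued bounded functions. -/

variable {k : X → X → ℝ} {π : X → ℝ} {f : X → ℝ} {c C : ℝ}

theorem IsReversibleChain.esemigroup_le (hk : IsReversibleChain k π)
    (hC : ∀ x, f x ≤ C) {t : ℝ} (ht : 0 ≤ t) (x : X) :
    esemigroup k t (fun y => ENNReal.ofReal (f y)) x ≤ ENNReal.ofReal C := by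
  calc _ ≤ ∑' y, trans k t x y * ENNReal.ofReal C :=
        ENNReal.tsum_le_tsum fun y => by dsimp only; gcongr; exact hC y
    _ = _ := by rw [ENNReal.tsum_mul_right, hk.nonexplosive t ht x, one_mul]

/-- The lower bound survives because `p_t(x,·)` has full mass: nothing is lost by explosion. This
keeps `log P_t f` bounded. -/
theorem IsReversibleChain.le_esemigroup (hk : IsReversibleChain k π)
    (hc : ∀ x, c ≤ f x) {t : ℝ} (ht : 0 ≤ t) (x : X) :
    ENNReal.ofReal c ≤ esemigroup k t (fun y => ENNReal.ofReal (f y)) x := by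
  calc _ = ∑' y, trans k t x y * ENNReal.ofReal c := by
        rw [ENNReal.tsum_mul_right, hk.nonexplosive t ht x, one_mul]
    _ ≤ _ := ENNReal.tsum_le_tsum fun y => by dsimp only; gcongr; exact hc y

theorem IsReversibleChain.semigroup_eq_toReal (hk : IsReversibleChain k π) (hf : ∀ x, 0 ≤ f x)
    {t : ℝ} (ht : 0 ≤ t) (x : X) :
    semigroup k t f x = (esemigroup k t (fun y => ENNReal.ofReal (f y)) x).toReal := by
  have h1 : ∀ y, trans k t x y ≠ ∞ := fun y =>
    ne_top_of_le_ne_top ENNReal.one_ne_top ((ENNReal.le_tsum y).trans (hk.nonexplosive t ht x).le)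
  rw [semigroup, esemigroup, ENNReal.tsum_toReal_eq fun y =>
    ENNReal.mul_ne_top (h1 y) ENNReal.ofReal_ne_top]
  exact tsum_congr fun y => by rw [ENNReal.toReal_mul, ENNReal.toReal_ofReal (hf y)]

theorem IsReversibleChain.semigroup_mem_Icc (hk : IsReversibleChain k π) (hc0 : 0 ≤ c)
    (hf : ∀ x, f x ∈ Icc c C) {t : ℝ} (ht : 0 ≤ t) (x : X) : semigroup k t f x ∈ Icc c C := by
  have hC0 : 0 ≤ C := hc0.trans ((hf x).1.trans (hf x).2)
  have hU := hk.esemigroup_le (fun x => (hf x).2) ht x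
  have hL := hk.le_esemigroup (fun x => (hf x).1) ht x
  rw [hk.semigroup_eq_toReal (fun x => hc0.trans (hf x).1) ht x]
  exact ⟨(ENNReal.ofReal_le_iff_le_toReal (ne_top_of_le_ne_top ENNReal.ofReal_ne_top hU)).1 hL,
    ENNReal.toReal_le_of_le_ofReal hC0 hU⟩

/-- The integrated backward equation of the semigroup, extended to negative times by `P_t = P_0`. -/
theorem IsReversibleChain.semigroup_max_eq [Countable X] (hk : IsReversibleChain k π) (hc0 : 0 ≤ c)
    (hf : ∀ x, f x ∈ Icc c C) (x : X) :
    Measurable (fun r => ∑' z, jumpRate k x z * semigroup k (max r 0) f z) ∧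
    ∀ t, semigroup k (max t 0) f x = Real.exp (-(M₁ k x * max t 0)) * (f x +
      ∫ r in (0 : ℝ)..max t 0, Real.exp (M₁ k x * r) *
        ∑' z, jumpRate k x z * semigroup k (max r 0) f z) := by
  have hf0 : ∀ x, 0 ≤ f x := fun x => hc0.trans (hf x).1
  have hu : ∀ t x, semigroup k (max t 0) f x ∈ Icc c C := fun t x =>
    hk.semigroup_mem_Icc hc0 hf (le_max_right t 0) x
  have hu0 : ∀ t x, 0 ≤ semigroup k (max t 0) f x := fun t x => hc0.trans (hu t x).1
  have hue : ∀ t, 0 ≤ t → ∀ x, esemigroup k t (fun y => ENNReal.ofReal (f y)) x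
      = ENNReal.ofReal (semigroup k t f x) := fun t ht x => by
    rw [hk.semigroup_eq_toReal hf0 ht, ENNReal.ofReal_toReal]
    exact ne_top_of_le_ne_top ENNReal.ofReal_ne_top (hk.esemigroup_le (fun x => (hf x).2) ht x)
  have hsum : ∀ t, Summable fun z => jumpRate k x z * semigroup k (max t 0) f z := fun t =>
    hk.summable_jumpRate_mul (C := C)
      (fun z => by rw [abs_of_nonneg (hu0 t z)]; exact (hu t z).2) x
  have hterm : ∀ t z, 0 ≤ jumpRate k x z * semigroup k (max t 0) f z := fun t z =>
    mul_nonneg (hk.jumpRate_nonneg x z) (hu0 t z)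
  have hv : ∀ t, ENNReal.ofReal (∑' z, jumpRate k x z * semigroup k (max t 0) f z) =
      ∑' z, ENNReal.ofReal (jumpRate k x z) *
        esemigroup k (max t 0) (fun y => ENNReal.ofReal (f y)) z := fun t => by
    rw [ENNReal.ofReal_tsum_of_nonneg (hterm t) (hsum t)]
    refine tsum_congr fun z => ?_
    rw [ENNReal.ofReal_mul (hk.jumpRate_nonneg x z), hue _ (le_max_right t 0)]
  have hv0 : ∀ t, 0 ≤ ∑' z, jumpRate k x z * semigroup k (max t 0) f z := fun t =>
    tsum_nonneg (hterm t)
  have hmeas : Measurable (fun r => ∑' z, jumpRate k x z * semigroup k (max r 0) f z) := by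
    have : Measurable fun r => (∑' z, ENNReal.ofReal (jumpRate k x z) *
        esemigroup k (max r 0) (fun y => ENNReal.ofReal (f y)) z).toReal :=
      (Measurable.tsum fun z => ((measurable_esemigroup k _ z).comp
        (measurable_id.max measurable_const)).const_mul _).ennreal_toReal
    simpa only [← hv, ENNReal.toReal_ofReal (hv0 _)] using this
  refine ⟨hmeas, fun t => ?_⟩
  obtain ⟨T, hT⟩ : ∃ T, max t 0 = T := ⟨_, rfl⟩
  have hT0 : 0 ≤ T := hT ▸ le_max_right t 0
  rw [hT]
  set v : ℝ → ℝ := fun r => ∑' z, jumpRate k x z * semigroup k (max r 0) f z with hvdef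
  have e₁ : ∫⁻ s in Ioc 0 T, ENNReal.ofReal (Real.exp (-(M₁ k x * s))) *
        ∑' z, ENNReal.ofReal (jumpRate k x z) *
          esemigroup k (T - s) (fun y => ENNReal.ofReal (f y)) z =
      ∫⁻ s in Ioc 0 T, ENNReal.ofReal (Real.exp (-(M₁ k x * s)) * v (T - s)) := by
    refine setLIntegral_congr_fun measurableSet_Ioc fun s hs => ?_
    rw [ENNReal.ofReal_mul (Real.exp_pos _).le, hvdef]
    rw [hv, max_eq_left (sub_nonneg.2 hs.2)]
  have e₂ := esemigroup_eq k T (fun y => ENNReal.ofReal (f y)) x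
  rw [e₁, hue T hT0 x, ← ENNReal.ofReal_mul (Real.exp_pos _).le] at e₂
  have hmI : Measurable fun s => Real.exp (-(M₁ k x * s)) * v (T - s) :=
    Measurable.mul (by fun_prop) (hmeas.comp (measurable_const.sub measurable_id))
  have e₃ : ∫ s in Ioc 0 T, Real.exp (-(M₁ k x * s)) * v (T - s) =
      (∫⁻ s in Ioc 0 T, ENNReal.ofReal (Real.exp (-(M₁ k x * s)) * v (T - s))).toReal :=
    integral_eq_lintegral_of_nonneg_ae
      (ae_of_all _ fun s => mul_nonneg (Real.exp_pos _).le (hv0 _)) hmI.aestronglyMeasurable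
  -- An infinite integral would make the finite value `P_T f(x)` infinite.
  have hfin : ∫⁻ s in Ioc 0 T, ENNReal.ofReal (Real.exp (-(M₁ k x * s)) * v (T - s)) ≠ ∞ := by
    intro h
    rw [h, add_top] at e₂
    exact ENNReal.ofReal_ne_top e₂
  have e₄ := congrArg ENNReal.toReal e₂
  have hs0 : 0 ≤ semigroup k T f x := hT ▸ hu0 t x
  rw [ENNReal.toReal_add ENNReal.ofReal_ne_top hfin, ← e₃, ENNReal.toReal_ofReal hs0,
    ENNReal.toReal_ofReal (mul_nonneg (Real.exp_pos _).le (hf0 x))] at e₄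
  rw [e₄, mul_add, ← intervalIntegral.integral_of_le hT0, ← intervalIntegral.integral_const_mul]
  congr 1
  -- The substitution `r = T - s` leaves the time only in a prefactor and in the upper limit, a form
  -- ready to be differentiated.
  have := intervalIntegral.integral_comp_sub_left
    (fun r => Real.exp (-(M₁ k x * T)) * (Real.exp (M₁ k x * r) * v r)) (a := 0) (b := T) T
  rw [sub_self, sub_zero] at this
  rw [← this]
  refine intervalIntegral.integral_congr fun s _ => ?_
  rw [← mul_assoc, ← Real.exp_add]
  congr 2
  ring

/-- First half of a bootstrap: a locally bounded measurable integrand has a continuous primitive.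
Continuity of `P_t f` then makes the integrand itself continuous, which yields differentiability in
`hasDerivAt_semigroup`. -/
theorem IsReversibleChain.continuous_semigroup_max [Countable X] (hk : IsReversibleChain k π)
    (hc0 : 0 ≤ c) (hf : ∀ x, f x ∈ Icc c C) (x : X) :
    Continuous fun t => semigroup k (max t 0) f x := by
  obtain ⟨hmeas, heq⟩ := hk.semigroup_max_eq hc0 hf x
  simp only [heq]
  have hint : ∀ a b, IntervalIntegrable (fun r => Real.exp (M₁ k x * r) *
      ∑' z, jumpRate k x z * semigroup k (max r 0) f z) volume a b := by
    intro a b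
    have hE : Continuous fun r => Real.exp (M₁ k x * r) * (M₁ k x * C) := by fun_prop
    refine (hE.intervalIntegrable a b).mono_fun
      (Measurable.mul (by fun_prop) hmeas).aestronglyMeasurable (ae_of_all _ fun r => ?_)
    simp only [norm_mul]
    refine mul_le_mul_of_nonneg_left ?_ (norm_nonneg _)
    rw [← norm_mul]
    refine le_trans (tsum_of_norm_bounded ((hk.M₁_finite x).mul_right C).hasSum fun z => ?_) ?_
    · have := hk.semigroup_mem_Icc hc0 hf (le_max_right r 0) z
      rw [norm_mul, Real.norm_of_nonneg (hk.jumpRate_nonneg x z),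
        Real.norm_of_nonneg (hc0.trans this.1)]
      exact mul_le_mul_of_nonneg_left this.2 (hk.jumpRate_nonneg x z)
    · rw [tsum_mul_right]
      exact Real.le_norm_self _
  have := (intervalIntegral.continuous_primitive hint 0).comp
    (continuous_id.max (continuous_const (y := (0 : ℝ))))
  exact Continuous.mul (by fun_prop) (continuous_const.add this)

theorem IsReversibleChain.continuousOn_semigroup [Countable X] (hk : IsReversibleChain k π)
    (hc0 : 0 ≤ c) (hf : ∀ x, f x ∈ Icc c C) (x : X) :
    ContinuousOn (fun t => semigroup k t f x) (Ici 0) :=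
  (hk.continuous_semigroup_max hc0 hf x).continuousOn.congr fun t ht => by
    simp only [max_eq_left (mem_Ici.1 ht)]

theorem IsReversibleChain.semigroup_zero [Countable X] (hk : IsReversibleChain k π)
    (hc0 : 0 ≤ c) (hf : ∀ x, f x ∈ Icc c C) : semigroup k 0 f = f := by
  funext x
  simpa using (hk.semigroup_max_eq hc0 hf x).2 0

/-- The backward equation `∂_t P_t f = L P_t f`. -/
theorem IsReversibleChain.hasDerivAt_semigroup [Countable X] (hk : IsReversibleChain k π)
    (hc0 : 0 ≤ c) (hf : ∀ x, f x ∈ Icc c C) {t : ℝ} (ht : 0 < t) (x : X) :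
    HasDerivAt (fun t => semigroup k t f x) (gen k (semigroup k t f) x) t := by
  obtain ⟨-, heq⟩ := hk.semigroup_max_eq hc0 hf x
  -- Uniform domination by `C · jumpRate k x z` carries continuity to the sum, so the fundamental
  -- theorem of calculus applies.
  have hcont : Continuous fun r => ∑' z, jumpRate k x z * semigroup k (max r 0) f z := by
    refine continuous_tsum (fun z => (hk.continuous_semigroup_max hc0 hf z).const_mul _)
      ((hk.M₁_finite x).mul_right C) fun z r => ?_
    have := hk.semigroup_mem_Icc hc0 hf (le_max_right r 0) z
    rw [norm_mul, Real.norm_of_nonneg (hk.jumpRate_nonneg x z),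
      Real.norm_of_nonneg (hc0.trans this.1)]
    exact mul_le_mul_of_nonneg_left this.2 (hk.jumpRate_nonneg x z)
  have hW : Continuous fun r => Real.exp (M₁ k x * r) *
      ∑' z, jumpRate k x z * semigroup k (max r 0) f z := Continuous.mul (by fun_prop) hcont
  have h1 := (hW.integral_hasStrictDerivAt 0 t).hasDerivAt.const_add (f x)
  have h2 : HasDerivAt (fun t => Real.exp (-(M₁ k x * t)))
      (Real.exp (-(M₁ k x * t)) * -(M₁ k x * 1)) t :=
    ((hasDerivAt_id t).const_mul (M₁ k x)).neg.exp
  have h3 := h2.mul h1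
  refine (h3.congr_of_eventuallyEq ?_).congr_deriv ?_
  · filter_upwards [lt_mem_nhds ht] with s hs
    have := heq s
    rw [max_eq_left hs.le] at this
    exact this
  have hb : ∀ z, |semigroup k t f z| ≤ C := fun z => by
    have := hk.semigroup_mem_Icc hc0 hf ht.le z
    rw [abs_of_nonneg (hc0.trans this.1)]
    exact this.2
  have := heq t
  rw [max_eq_left ht.le] at this ⊢
  rw [hk.gen_eq_sub hb, this, ← mul_assoc, ← Real.exp_add, neg_add_cancel, Real.exp_zero]
  ring

end Backward

section Integrated

/-! ### The second order calculus integrated against a density -/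

theorem hasSum_of_forall_eq {α : Type*} {f g : α → ℝ} {s : ℝ} (hf : HasSum f s)
    (h : ∀ x, g x = f x) : HasSum g s :=
  funext h ▸ hf

theorem abs_le_of_mem_Icc {r c C : ℝ} (hc : 0 < c) (hr : r ∈ Icc c C) : |r| ≤ C := by
  rw [abs_of_pos (hc.trans_le hr.1)]; exact hr.2

theorem abs_log_le_of_mem_Icc {r c C : ℝ} (hc : 0 < c) (hr : r ∈ Icc c C) :
    |Real.log r| ≤ |Real.log c| + |Real.log C| := by
  have h₁ := Real.log_le_log hc hr.1
  have h₂ := Real.log_le_log (hc.trans_le hr.1) hr.2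
  rw [abs_le]
  constructor
  · linarith [neg_abs_le (Real.log c), abs_nonneg (Real.log C)]
  · linarith [le_abs_self (Real.log C), abs_nonneg (Real.log c)]

theorem abs_div_le_of_mem_Icc {a r c C B : ℝ} (hc : 0 < c) (hr : r ∈ Icc c C) (ha : |a| ≤ B) :
    |a / r| ≤ B / c := by
  rw [abs_div, abs_of_pos (hc.trans_le hr.1)]
  exact div_le_div₀ ((abs_nonneg _).trans ha) ha hc hr.1

theorem norm_mul_sub_mul_sub_le {w a b a' b' A B : ℝ} (hw : 0 ≤ w) (ha : |a' - a| ≤ A)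
    (hb : |b' - b| ≤ B) : ‖w * ((a' - a) * (b' - b))‖ ≤ w * (A * B) := by
  rw [norm_mul, norm_mul, Real.norm_of_nonneg hw]
  exact mul_le_mul_of_nonneg_left
    (mul_le_mul ha hb (abs_nonneg _) ((abs_nonneg _).trans ha)) hw

theorem abs_sub_le_add_of_le {a b A B : ℝ} (ha : |a| ≤ A) (hb : |b| ≤ B) : |b - a| ≤ A + B := by
  have := norm_sub_le b a
  simp only [Real.norm_eq_abs] at this
  linarith

theorem sub_mul_log_sub_log_nonneg {a b : ℝ} (ha : 0 < a) (hb : 0 < b) :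
    0 ≤ (b - a) * (Real.log b - Real.log a) := by
  rcases le_total a b with h | h
  · exact mul_nonneg (sub_nonneg.2 h) (sub_nonneg.2 (Real.log_le_log ha h))
  · exact mul_nonneg_of_nonpos_of_nonpos (sub_nonpos.2 h) (sub_nonpos.2 (Real.log_le_log hb h))

/-- The logarithm has slope at least `1/C` on `(0, C]`. Through this a small Fisher information
forces small differences along edges. -/
theorem sq_sub_div_le_sub_mul_log_sub_log {a b C : ℝ} (ha : 0 < a) (hb : 0 < b) (haC : a ≤ C)
    (hbC : b ≤ C) : (b - a) ^ 2 / C ≤ (b - a) * (Real.log b - Real.log a) := by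
  wlog h : a ≤ b generalizing a b
  · have := this hb ha hbC haC (le_of_not_ge h)
    calc (b - a) ^ 2 / C = (a - b) ^ 2 / C := by ring
      _ ≤ _ := this
      _ = _ := by ring
  have h₁ := Real.log_le_sub_one_of_pos (div_pos ha hb)
  rw [Real.log_div ha.ne' hb.ne'] at h₁
  have h₂ : (b - a) / C ≤ (b - a) / b := div_le_div_of_nonneg_left (sub_nonneg.2 h) hb hbC
  have h₃ : (b - a) / b = 1 - a / b := by field_simp
  calc (b - a) ^ 2 / C = (b - a) * ((b - a) / C) := by ring
    _ ≤ _ := mul_le_mul_of_nonneg_left (by linarith) (sub_nonneg.2 h)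

variable {k : X → X → ℝ} {π : X → ℝ} {u : X → ℝ} {c C : ℝ}

namespace IsReversibleChain

/-- The exponential in `Υ` undoes the logarithm: `e^{log u(y) - log u(x)} - 1 = (u(y) - u(x)) /
u(x)`. -/
theorem Psi_upsilon_log (hk : IsReversibleChain k π) (hc : 0 < c) (hu : ∀ x, u x ∈ Icc c C)
    (x : X) : Psi k upsilon (fun y => Real.log (u y)) x
      = gen k u x / u x - gen k (fun y => Real.log (u y)) x := by
  have hpos : ∀ x, 0 < u x := fun x => hc.trans_le (hu x).1
  have h := ((hk.hasSum_gen (fun x => abs_le_of_mem_Icc hc (hu x)) x).div_const (u x)).sub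
    (hk.hasSum_gen (fun x => abs_log_le_of_mem_Icc hc (hu x)) x)
  rw [← h.tsum_eq]
  refine tsum_congr fun y => ?_
  rw [jumpRate_mul_of_diag k x y (by rintro rfl; simp [upsilon]), upsilon, Real.exp_sub,
    Real.exp_log (hpos y), Real.exp_log (hpos x)]
  have := (hpos x).ne'
  field_simp

theorem abs_gen_div_le (hk : IsReversibleChain k π) (hc : 0 < c) (hu : ∀ x, u x ∈ Icc c C)
    (x : X) : |gen k u x / u x| ≤ 2 * C / c * M₁ k x := by
  have := abs_div_le_of_mem_Icc hc (hu x) (hk.abs_gen_le (fun x => abs_le_of_mem_Icc hc (hu x)) x)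
  rwa [mul_div_right_comm] at this

theorem abs_Psi_upsilon_log_le (hk : IsReversibleChain k π) (hc : 0 < c)
    (hu : ∀ x, u x ∈ Icc c C) (x : X) : |Psi k upsilon (fun y => Real.log (u y)) x|
      ≤ (2 * (|Real.log c| + |Real.log C|) + 2 * C / c) * M₁ k x := by
  rw [hk.Psi_upsilon_log hc hu, add_mul]
  exact abs_sub_le_add_of_le (hk.abs_gen_le (fun x => abs_log_le_of_mem_Icc hc (hu x)) x)
    (hk.abs_gen_div_le hc hu x)

theorem energy_one_left (k : X → X → ℝ) (π u : X → ℝ) : energy k π (fun _ => 1) u = 0 := by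
  simp [energy]

theorem hasSum_gen_zero (hk : IsReversibleChain k π) (hM₁ : Summable fun x => M₁ k x ^ 2 * π x)
    {A : ℝ} (hu : ∀ x, |u x| ≤ A) : HasSum (fun x => π x * gen k u x) 0 := by
  have := hk.hasSum_mul_gen_of_bounded hM₁ (a := fun _ => 1) (A := 1) (by simp) hu
  rw [energy_one_left] at this
  simpa using this

/-- `∑ u Ψ_Υ(log u) π = ½ ∑ π(x) k(x,y) (u(y) - u(x)) (log u(y) - log u(x))`. -/
theorem hasSum_mul_Psi (hk : IsReversibleChain k π) (hM₁ : Summable fun x => M₁ k x ^ 2 * π x)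
    (hc : 0 < c) (hu : ∀ x, u x ∈ Icc c C) :
    HasSum (fun x => π x * (u x * Psi k upsilon (fun y => Real.log (u y)) x))
      (1 / 2 * energy k π u fun y => Real.log (u y)) := by
  have h := (hk.hasSum_gen_zero hM₁ fun x => abs_le_of_mem_Icc hc (hu x)).sub
    (hk.hasSum_mul_gen_of_bounded hM₁ (fun x => abs_le_of_mem_Icc hc (hu x))
      fun x => abs_log_le_of_mem_Icc hc (hu x))
  rw [show (1 / 2 * energy k π u fun y => Real.log (u y)) =
    0 - -(1 / 2) * energy k π u fun y => Real.log (u y) by ring]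
  refine hasSum_of_forall_eq h fun x => ?_
  have := (hc.trans_le (hu x).1).ne'
  rw [hk.Psi_upsilon_log hc hu]
  field_simp

theorem summable_energy_of_growth (hk : IsReversibleChain k π)
    (hM₁ : Summable fun x => M₁ k x ^ 2 * π x) {a b : X → ℝ} {A B : ℝ}
    (ha : ∀ x, |a x| ≤ A) (hb : ∀ x, |b x| ≤ B * M₁ k x) :
    Summable fun p : X × X => edgeWeight k π p * ((a p.2 - a p.1) * (b p.2 - b p.1)) := by
  refine Summable.of_norm_bounded (((hk.summable_edgeWeight_mul_M₁_fst hM₁).add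
    (hk.summable_edgeWeight_mul_M₁_snd hM₁)).mul_left ((A + A) * B)) fun p => ?_
  refine (norm_mul_sub_mul_sub_le (hk.edgeWeight_nonneg p) (abs_sub_le_add_of_le (ha _) (ha _))
    (abs_sub_le_add_of_le (hb _) (hb _))).trans_eq ?_
  ring

theorem summable_energy_of_bounded (hk : IsReversibleChain k π)
    (hM₁ : Summable fun x => M₁ k x ^ 2 * π x) {a b : X → ℝ} {A B : ℝ}
    (ha : ∀ x, |a x| ≤ A) (hb : ∀ x, |b x| ≤ B) :
    Summable fun p : X × X => edgeWeight k π p * ((a p.2 - a p.1) * (b p.2 - b p.1)) :=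
  Summable.of_norm_bounded ((hk.summable_edgeWeight hM₁).mul_right ((A + A) * (B + B))) fun p =>
    norm_mul_sub_mul_sub_le (hk.edgeWeight_nonneg p) (abs_sub_le_add_of_le (ha _) (ha _))
      (abs_sub_le_add_of_le (hb _) (hb _))

/-- Since `u(x) Υ'(log u(y) - log u(x)) = u(y) - u(x)`, the weight `u` turns the nonlinear operator
into the Dirichlet form. -/
theorem hasSum_mul_Bop (hk : IsReversibleChain k π) (hM₁ : Summable fun x => M₁ k x ^ 2 * π x)
    (hc : 0 < c) (hu : ∀ x, u x ∈ Icc c C) {b : X → ℝ} {B : ℝ} (hb : ∀ x, |b x| ≤ B * M₁ k x) :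
    HasSum (fun x => π x * (u x * Bop k (deriv upsilon) (fun y => Real.log (u y)) b x))
      (energy k π u b) := by
  have S := hk.summable_energy_of_growth hM₁ (fun x => abs_le_of_mem_Icc hc (hu x)) hb
  have key := S.hasSum.prod_fiberwise fun x => (S.prod_factor x).hasSum
  refine hasSum_of_forall_eq key fun x => ?_
  rw [Bop, ← tsum_mul_left, ← tsum_mul_left]
  refine tsum_congr fun y => ?_
  have hx := hc.trans_le (hu x).1
  rw [deriv_upsilon, Real.exp_sub, Real.exp_log hx, Real.exp_log (hc.trans_le (hu y).1), mul_assoc,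
    jumpRate_mul_of_diag k x y (by rintro rfl; simp), edgeWeight]
  have := hx.ne'
  field_simp

theorem hasSum_mul_Psi2 (hk : IsReversibleChain k π) (hM₁ : Summable fun x => M₁ k x ^ 2 * π x)
    (hc : 0 < c) (hu : ∀ x, u x ∈ Icc c C) :
    HasSum (fun x => π x * (u x * Psi2 k (fun y => Real.log (u y)) x))
      (1 / 2 * (-(1 / 2) * energy k π u (Psi k upsilon fun y => Real.log (u y)) -
        energy k π u (gen k fun y => Real.log (u y)))) := by
  have h := ((hk.hasSum_mul_gen_of_bounded_left hM₁ (fun x => abs_le_of_mem_Icc hc (hu x))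
    (hk.abs_Psi_upsilon_log_le hc hu)).sub (hk.hasSum_mul_Bop hM₁ hc hu
      (hk.abs_gen_le fun x => abs_log_le_of_mem_Icc hc (hu x)))).mul_left (1 / 2)
  refine hasSum_of_forall_eq h fun x => ?_
  rw [Psi2]
  ring

/-- The integrated curvature-dimension inequality. -/
theorem energy_gen_add_le (hk : IsReversibleChain k π) (hM₁ : Summable fun x => M₁ k x ^ 2 * π x)
    {κ : ℝ} (hCD : CDUpsilon k κ) (hc : 0 < c) (hu : ∀ x, u x ∈ Icc c C) :
    energy k π (gen k u) (fun y => Real.log (u y)) + energy k π u (fun y => gen k u y / u y)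
      ≤ -(2 * κ) * energy k π u (fun y => Real.log (u y)) := by
  have hu' : ∀ x, |u x| ≤ C := fun x => abs_le_of_mem_Icc hc (hu x)
  have hlog : ∀ x, |Real.log (u x)| ≤ |Real.log c| + |Real.log C| :=
    fun x => abs_log_le_of_mem_Icc hc (hu x)
  have hmem : Memℓp (fun y => Real.log (u y)) ∞ :=
    memℓp_infty_iff.2 ⟨_, by rintro _ ⟨x, rfl⟩; exact hlog x⟩
  have h₁ := hasSum_le (fun x => ?_) ((hk.hasSum_mul_Psi hM₁ hc hu).mul_left κ)
    (hk.hasSum_mul_Psi2 hM₁ hc hu)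
  · have hLg := hk.hasSum_mul_gen_of_bounded_right hM₁ (hk.abs_gen_le hlog) hu'
    have hLu := hk.hasSum_mul_gen_of_bounded_right hM₁ (hk.abs_gen_le hu') hlog
    have hdiv := hk.hasSum_mul_gen_of_bounded_right hM₁ (hk.abs_gen_div_le hc hu) hu'
    have hPsi := hk.hasSum_mul_gen_of_bounded_right hM₁ (hk.abs_Psi_upsilon_log_le hc hu) hu'
    -- Both energies equal `-2 ∑ π (Lu)(L log u)`. Together with `e₂`, the splitting of `Ψ_Υ(log
    -- u)`, this makes `∑ π u Ψ_{2,Υ}(log u)` equal to `-¼` of the left side of the goal, while `∑ π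
    -- u Ψ_Υ(log u)` is half the energy; hence the factor `-2κ`.
    have e₁ := hLg.unique (hasSum_of_forall_eq hLu fun x => by ring)
    have e₂ := hPsi.unique (hasSum_of_forall_eq (hdiv.sub hLg) fun x => by
      rw [hk.Psi_upsilon_log hc hu]; ring)
    simp only [energy_comm k π _ u] at e₁ e₂
    linarith
  · have := mul_le_mul_of_nonneg_left (hCD _ hmem x)
      (mul_nonneg (hk.density_pos x).le (hc.le.trans (hu x).1))
    calc _ = _ := by ring
      _ ≤ _ := this
      _ = _ := by ring

end IsReversibleChain
end Integrated

section Decay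

/-! ### Entropy and Fisher information along the semigroup -/

variable {k : X → X → ℝ} {π : X → ℝ} {f : X → ℝ} {c C : ℝ} {κ : ℝ}

theorem abs_mul_log_le_of_mem_Icc {r : ℝ} (hc : 0 < c) (hr : r ∈ Icc c C) :
    |r * Real.log r| ≤ C * (|Real.log c| + |Real.log C|) := by
  rw [abs_mul]
  exact mul_le_mul (abs_le_of_mem_Icc hc hr) (abs_log_le_of_mem_Icc hc hr) (abs_nonneg _)
    ((hc.le.trans hr.1).trans hr.2)

theorem monotoneOn_Ici_of_hasDerivAt_nonneg {F F' : ℝ → ℝ} (hF : ContinuousOn F (Ici 0))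
    (hd : ∀ t, 0 < t → HasDerivAt F (F' t) t) (h : ∀ t, 0 < t → 0 ≤ F' t) :
    MonotoneOn F (Ici 0) := by
  refine monotoneOn_of_deriv_nonneg (convex_Ici 0) hF (fun s hs => ?_) fun s hs => ?_ <;>
    rw [interior_Ici] at hs
  · exact (hd s hs).differentiableAt.differentiableWithinAt
  · exact (h s hs).trans_eq (hd s hs).deriv.symm

/-- Grönwall: `e^{at} F(t)` is nonincreasing. Continuity suffices at the endpoint `0`, where no
derivative is available. -/
theorem le_exp_mul_of_hasDerivAt_le {F F' : ℝ → ℝ} {a : ℝ} (hF : ContinuousOn F (Ici 0))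
    (hd : ∀ t, 0 < t → HasDerivAt F (F' t) t) (h : ∀ t, 0 < t → F' t ≤ -a * F t) {t : ℝ}
    (ht : 0 ≤ t) : F t ≤ Real.exp (-(a * t)) * F 0 := by
  have hmono := monotoneOn_Ici_of_hasDerivAt_nonneg
    (F := fun t => -(Real.exp (a * t) * F t))
    (F' := fun t => -(Real.exp (a * t) * (a * 1) * F t + Real.exp (a * t) * F' t))
    (ContinuousOn.mul (by fun_prop) hF).neg
    (fun t ht => (((hasDerivAt_id t).const_mul a).exp.mul (hd t ht)).neg) fun t ht => by
      nlinarith [mul_le_mul_of_nonneg_left (h t ht) (Real.exp_pos (a * t)).le]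
  have := neg_le_neg (hmono self_mem_Ici ht ht)
  simp only [neg_neg, mul_zero, Real.exp_zero, one_mul] at this
  rwa [Real.exp_neg, inv_mul_eq_div, le_div_iff₀ (Real.exp_pos _), mul_comm]

namespace IsReversibleChain

theorem summable_density_mul (hk : IsReversibleChain k π) {a : X → ℝ} {A : ℝ}
    (ha : ∀ x, |a x| ≤ A) : Summable fun x => π x * a x := by
  refine Summable.of_norm_bounded (hk.density_sum.summable.mul_right A) fun x => ?_
  rw [norm_mul, Real.norm_of_nonneg (hk.density_pos x).le]
  exact mul_le_mul_of_nonneg_left (ha x) (hk.density_pos x).le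

/-- Termwise differentiation of `∑ π(x) φ(t,x)` when `∂_t φ = O(M₁)`. -/
theorem hasDerivAt_tsum_density (hk : IsReversibleChain k π)
    (hM₁ : Summable fun x => M₁ k x ^ 2 * π x) {φ φ' : ℝ → X → ℝ} {A B : ℝ}
    (hφ : ∀ t, 0 < t → ∀ x, HasDerivAt (fun t => φ t x) (φ' t x) t)
    (hA : ∀ t, 0 < t → ∀ x, |φ t x| ≤ A) (hB : ∀ t, 0 < t → ∀ x, |φ' t x| ≤ B * M₁ k x)
    {t : ℝ} (ht : 0 < t) :
    HasDerivAt (fun t => ∑' x, π x * φ t x) (∑' x, π x * φ' t x) t := by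
  refine hasDerivAt_tsum_of_isPreconnected (t := Ioi 0) ((hk.summable_M₁_mul hM₁).mul_right B)
    isOpen_Ioi isPreconnected_Ioi (fun x s hs => (hφ s hs x).const_mul (π x)) (fun x s hs => ?_)
    ht (hk.summable_density_mul (hA t ht)) ht
  rw [norm_mul, Real.norm_of_nonneg (hk.density_pos x).le, mul_assoc]
  refine mul_le_mul_of_nonneg_left ((hB s hs x).trans_eq (mul_comm _ _)) (hk.density_pos x).le

theorem continuousOn_tsum_density (hk : IsReversibleChain k π) {φ : ℝ → X → ℝ} {A : ℝ}
    (hφ : ∀ x, ContinuousOn (fun t => φ t x) (Ici 0)) (hA : ∀ t, 0 ≤ t → ∀ x, |φ t x| ≤ A) :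
    ContinuousOn (fun t => ∑' x, π x * φ t x) (Ici 0) := by
  refine continuousOn_tsum (fun x => continuousOn_const.mul (hφ x))
    (hk.density_sum.summable.mul_right A) fun x t ht => ?_
  rw [norm_mul, Real.norm_of_nonneg (hk.density_pos x).le]
  exact mul_le_mul_of_nonneg_left (hA t ht x) (hk.density_pos x).le

theorem energy_log_nonneg (hk : IsReversibleChain k π) (hf : ∀ x, 0 < f x) :
    0 ≤ energy k π f fun x => Real.log (f x) :=
  tsum_nonneg fun p => mul_nonneg (hk.edgeWeight_nonneg p) (sub_mul_log_sub_log_nonneg (hf _) (hf _))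

theorem abs_gen_semigroup_le (hk : IsReversibleChain k π) (hc : 0 < c) (hf : ∀ x, f x ∈ Icc c C)
    {t : ℝ} (ht : 0 ≤ t) (x : X) : |gen k (semigroup k t f) x| ≤ 2 * C * M₁ k x :=
  hk.abs_gen_le (fun x => abs_le_of_mem_Icc hc (hk.semigroup_mem_Icc hc.le hf ht x)) x

section Flow

variable [Countable X]

theorem continuousOn_log_semigroup (hk : IsReversibleChain k π) (hc : 0 < c)
    (hf : ∀ x, f x ∈ Icc c C) (x : X) :
    ContinuousOn (fun t => Real.log (semigroup k t f x)) (Ici 0) :=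
  (hk.continuousOn_semigroup hc.le hf x).log fun _ ht =>
    (hc.trans_le (hk.semigroup_mem_Icc hc.le hf ht x).1).ne'

theorem hasDerivAt_log_semigroup (hk : IsReversibleChain k π) (hc : 0 < c)
    (hf : ∀ x, f x ∈ Icc c C) {t : ℝ} (ht : 0 < t) (x : X) :
    HasDerivAt (fun t => Real.log (semigroup k t f x))
      (gen k (semigroup k t f) x / semigroup k t f x) t :=
  (hk.hasDerivAt_semigroup hc.le hf ht x).log
    (hc.trans_le (hk.semigroup_mem_Icc hc.le hf ht.le x).1).ne'

/-- Conservation of mass. -/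
theorem tsum_density_mul_semigroup (hk : IsReversibleChain k π)
    (hM₁ : Summable fun x => M₁ k x ^ 2 * π x) (hc : 0 < c) (hf : ∀ x, f x ∈ Icc c C)
    {t : ℝ} (ht : 0 ≤ t) : ∑' x, π x * semigroup k t f x = ∑' x, π x * f x := by
  have hb : ∀ t, 0 ≤ t → ∀ x, |semigroup k t f x| ≤ C := fun t ht x =>
    abs_le_of_mem_Icc hc (hk.semigroup_mem_Icc hc.le hf ht x)
  have hd : ∀ t, 0 < t → HasDerivAt (fun t => ∑' x, π x * semigroup k t f x) 0 t := fun t ht => by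
    rw [← (hk.hasSum_gen_zero hM₁ (hb t ht.le)).tsum_eq]
    exact hk.hasDerivAt_tsum_density hM₁ (fun t ht => hk.hasDerivAt_semigroup hc.le hf ht)
      (fun t ht => hb t ht.le) (fun t ht => hk.abs_gen_semigroup_le hc hf ht.le) ht
  have hcont := hk.continuousOn_tsum_density (hk.continuousOn_semigroup hc.le hf) hb
  have h₁ := monotoneOn_Ici_of_hasDerivAt_nonneg hcont hd (fun _ _ => le_rfl)
  have h₂ := monotoneOn_Ici_of_hasDerivAt_nonneg hcont.neg (fun t ht => (hd t ht).neg)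
    (fun _ _ => neg_zero.ge)
  have := le_antisymm (neg_le_neg_iff.1 (h₂ self_mem_Ici ht ht)) (h₁ self_mem_Ici ht ht)
  simpa only [hk.semigroup_zero hc.le hf] using this

/-- The entropy dissipation identity `d/dt ℋ(P_t f) = -ℐ(P_t f)`. -/
theorem hasDerivAt_tsum_mul_log (hk : IsReversibleChain k π)
    (hM₁ : Summable fun x => M₁ k x ^ 2 * π x) (hc : 0 < c) (hf : ∀ x, f x ∈ Icc c C)
    {t : ℝ} (ht : 0 < t) :
    HasDerivAt (fun t => ∑' x, π x * (semigroup k t f x * Real.log (semigroup k t f x)))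
      (-(1 / 2) * energy k π (semigroup k t f) fun x => Real.log (semigroup k t f x)) t := by
  have hu : ∀ t, 0 ≤ t → ∀ x, semigroup k t f x ∈ Icc c C := fun t ht x =>
    hk.semigroup_mem_Icc hc.le hf ht x
  have hu' : ∀ x, |semigroup k t f x| ≤ C := fun x => abs_le_of_mem_Icc hc (hu t ht.le x)
  have hlog : ∀ x, |Real.log (semigroup k t f x)| ≤ |Real.log c| + |Real.log C| := fun x =>
    abs_log_le_of_mem_Icc hc (hu t ht.le x)
  -- The derivative of `r log r` is `log r + 1`; the summand `1` contributes nothing because `∑ π Lu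
  -- = 0`.
  have h := (hk.hasSum_mul_gen_of_bounded hM₁ hlog hu').add (hk.hasSum_gen_zero hM₁ hu')
  rw [add_zero, energy_comm] at h
  have h' := hasSum_of_forall_eq h (g := fun x => π x * (gen k (semigroup k t f) x *
    (Real.log (semigroup k t f x) + 1))) fun x => by ring
  rw [← h'.tsum_eq]
  refine hk.hasDerivAt_tsum_density hM₁ (A := C * (|Real.log c| + |Real.log C|))
    (B := 2 * C * (|Real.log c| + |Real.log C| + 1))
    (φ' := fun t x => gen k (semigroup k t f) x * (Real.log (semigroup k t f x) + 1))
    (fun s hs x => ?_) (fun s hs x => ?_) (fun s hs x => ?_) ht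
  · refine ((hk.hasDerivAt_semigroup hc.le hf hs x).mul
      (hk.hasDerivAt_log_semigroup hc hf hs x)).congr_deriv ?_
    have := (hc.trans_le (hu s hs.le x).1).ne'
    field_simp
  · exact abs_mul_log_le_of_mem_Icc hc (hu s hs.le x)
  · rw [abs_mul]
    have h1 := hk.abs_gen_semigroup_le hc hf hs.le x
    have h2 : |Real.log (semigroup k s f x) + 1| ≤ |Real.log c| + |Real.log C| + 1 := by
      refine (abs_add_le _ _).trans ?_
      rw [abs_one]
      gcongr
      exact abs_log_le_of_mem_Icc hc (hu s hs.le x)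
    exact (mul_le_mul h1 h2 (abs_nonneg _) ((abs_nonneg _).trans h1)).trans_eq (by ring)

theorem continuousOn_tsum_mul_log (hk : IsReversibleChain k π) (hc : 0 < c)
    (hf : ∀ x, f x ∈ Icc c C) : ContinuousOn
      (fun t => ∑' x, π x * (semigroup k t f x * Real.log (semigroup k t f x))) (Ici 0) :=
  hk.continuousOn_tsum_density
    (fun x => (hk.continuousOn_semigroup hc.le hf x).mul (hk.continuousOn_log_semigroup hc hf x))
    fun _ ht x => abs_mul_log_le_of_mem_Icc hc (hk.semigroup_mem_Icc hc.le hf ht x)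

theorem continuousOn_energy_log (hk : IsReversibleChain k π)
    (hM₁ : Summable fun x => M₁ k x ^ 2 * π x) (hc : 0 < c) (hf : ∀ x, f x ∈ Icc c C) :
    ContinuousOn (fun t => energy k π (semigroup k t f) fun x => Real.log (semigroup k t f x))
      (Ici 0) := by
  refine continuousOn_tsum (u := fun p => edgeWeight k π p *
    ((C + C) * (|Real.log c| + |Real.log C| + (|Real.log c| + |Real.log C|))))
    (fun p => continuousOn_const.mul ?_) ((hk.summable_edgeWeight hM₁).mul_right _)
    fun p t ht => ?_
  · exact ((hk.continuousOn_semigroup hc.le hf _).sub (hk.continuousOn_semigroup hc.le hf _)).mul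
      ((hk.continuousOn_log_semigroup hc hf _).sub (hk.continuousOn_log_semigroup hc hf _))
  · have hu := hk.semigroup_mem_Icc hc.le hf ht
    exact norm_mul_sub_mul_sub_le (hk.edgeWeight_nonneg p)
      (abs_sub_le_add_of_le (abs_le_of_mem_Icc hc (hu _)) (abs_le_of_mem_Icc hc (hu _)))
      (abs_sub_le_add_of_le (abs_log_le_of_mem_Icc hc (hu _)) (abs_log_le_of_mem_Icc hc (hu _)))

/-- Termwise product rule. Both resulting terms are dominated, uniformly in time, by a multiple of
`π(x) k(x,y) (M₁(x) + M₁(y))`, which is summable over pairs because `∑ M₁² π < ∞`. -/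
theorem hasDerivAt_energy_log (hk : IsReversibleChain k π)
    (hM₁ : Summable fun x => M₁ k x ^ 2 * π x) (hc : 0 < c) (hf : ∀ x, f x ∈ Icc c C)
    {t : ℝ} (ht : 0 < t) :
    HasDerivAt (fun t => energy k π (semigroup k t f) fun x => Real.log (semigroup k t f x))
      (energy k π (gen k (semigroup k t f)) (fun x => Real.log (semigroup k t f x)) +
        energy k π (semigroup k t f) fun x => gen k (semigroup k t f) x / semigroup k t f x) t := by
  have hu : ∀ t, 0 ≤ t → ∀ x, semigroup k t f x ∈ Icc c C := fun t ht x =>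
    hk.semigroup_mem_Icc hc.le hf ht x
  have hb : ∀ t, 0 < t → ∀ x, |semigroup k t f x| ≤ C := fun t ht x =>
    abs_le_of_mem_Icc hc (hu t ht.le x)
  have hg : ∀ t, 0 < t → ∀ x, |Real.log (semigroup k t f x)| ≤
      |Real.log c| + |Real.log C| := fun t ht x => abs_log_le_of_mem_Icc hc (hu t ht.le x)
  generalize |Real.log c| + |Real.log C| = G at hg
  have hL : ∀ t, 0 < t → ∀ x, |gen k (semigroup k t f) x| ≤ 2 * C * M₁ k x := fun t ht x =>
    hk.abs_gen_semigroup_le hc hf ht.le x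
  have hD : ∀ t, 0 < t → ∀ x, |gen k (semigroup k t f) x / semigroup k t f x|
      ≤ 2 * C / c * M₁ k x := fun t ht x => hk.abs_gen_div_le hc (hu t ht.le) x
  have S₁ := hk.summable_energy_of_growth hM₁ (hg t ht) (hL t ht)
  have S₂ := hk.summable_energy_of_growth hM₁ (hb t ht) (hD t ht)
  rw [energy_comm k π (gen k (semigroup k t f))]
  simp only [energy]
  rw [← S₁.tsum_add S₂]
  have hsum : Summable fun p : X × X => ((G + G) * (2 * C) + (C + C) * (2 * C / c)) *
      (edgeWeight k π p * M₁ k p.1 + edgeWeight k π p * M₁ k p.2) :=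
    ((hk.summable_edgeWeight_mul_M₁_fst hM₁).add
      (hk.summable_edgeWeight_mul_M₁_snd hM₁)).mul_left _
  have hderiv : ∀ (p : X × X) (s : ℝ), s ∈ Ioi (0 : ℝ) → HasDerivAt
      (fun t => edgeWeight k π p * ((semigroup k t f p.2 - semigroup k t f p.1) *
        (Real.log (semigroup k t f p.2) - Real.log (semigroup k t f p.1))))
      (edgeWeight k π p *
        ((Real.log (semigroup k s f p.2) - Real.log (semigroup k s f p.1)) *
          (gen k (semigroup k s f) p.2 - gen k (semigroup k s f) p.1)) +
      edgeWeight k π p * ((semigroup k s f p.2 - semigroup k s f p.1) *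
        (gen k (semigroup k s f) p.2 / semigroup k s f p.2 -
          gen k (semigroup k s f) p.1 / semigroup k s f p.1))) s := by
    intro p s hs
    have d := hk.hasDerivAt_semigroup hc.le hf hs
    have d' := hk.hasDerivAt_log_semigroup hc hf hs
    refine ((((d p.2).sub (d p.1)).mul ((d' p.2).sub (d' p.1))).const_mul
      (edgeWeight k π p)).congr_deriv ?_
    simp only [Pi.sub_apply]
    ring
  have hbound : ∀ (p : X × X) (s : ℝ), s ∈ Ioi (0 : ℝ) → ‖edgeWeight k π p *
        ((Real.log (semigroup k s f p.2) - Real.log (semigroup k s f p.1)) *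
          (gen k (semigroup k s f) p.2 - gen k (semigroup k s f) p.1)) +
      edgeWeight k π p * ((semigroup k s f p.2 - semigroup k s f p.1) *
        (gen k (semigroup k s f) p.2 / semigroup k s f p.2 -
          gen k (semigroup k s f) p.1 / semigroup k s f p.1))‖ ≤
      ((G + G) * (2 * C) + (C + C) * (2 * C / c)) *
        (edgeWeight k π p * M₁ k p.1 + edgeWeight k π p * M₁ k p.2) := by
    intro p s hs
    have n₁ := norm_mul_sub_mul_sub_le (hk.edgeWeight_nonneg p)
      (abs_sub_le_add_of_le (hg s hs p.1) (hg s hs p.2))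
      (abs_sub_le_add_of_le (hL s hs p.1) (hL s hs p.2))
    have n₂ := norm_mul_sub_mul_sub_le (hk.edgeWeight_nonneg p)
      (abs_sub_le_add_of_le (hb s hs p.1) (hb s hs p.2))
      (abs_sub_le_add_of_le (hD s hs p.1) (hD s hs p.2))
    exact (norm_add_le_of_le n₁ n₂).trans_eq (by ring)
  have hsum₀ := hk.summable_energy_of_bounded hM₁ (hb t ht) (hg t ht)
  exact hasDerivAt_tsum_of_isPreconnected hsum isOpen_Ioi isPreconnected_Ioi hderiv hbound
    (mem_Ioi.2 ht) hsum₀ (mem_Ioi.2 ht)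

/-- Exponential decay of the Fisher information along the semigroup. -/
theorem energy_log_semigroup_le (hk : IsReversibleChain k π)
    (hM₁ : Summable fun x => M₁ k x ^ 2 * π x) (hCD : CDUpsilon k κ) (hc : 0 < c)
    (hf : ∀ x, f x ∈ Icc c C) {t : ℝ} (ht : 0 ≤ t) :
    energy k π (semigroup k t f) (fun x => Real.log (semigroup k t f x)) ≤
      Real.exp (-(2 * κ * t)) * energy k π f fun x => Real.log (f x) := by
  have := le_exp_mul_of_hasDerivAt_le (hk.continuousOn_energy_log hM₁ hc hf)
    (fun t ht => hk.hasDerivAt_energy_log hM₁ hc hf ht)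
    (fun t ht => hk.energy_gen_add_le hM₁ hCD hc (hk.semigroup_mem_Icc hc.le hf ht.le)) ht
  simpa only [hk.semigroup_zero hc.le hf] using this

/-- A single edge term is bounded by the whole energy, which decays exponentially, so differences
vanish along each edge of positive rate; irreducibility joins any two points by finitely many such
edges. -/
theorem tendsto_semigroup_sub (hk : IsReversibleChain k π)
    (hM₁ : Summable fun x => M₁ k x ^ 2 * π x) (hκ : 0 < κ) (hCD : CDUpsilon k κ) (hc : 0 < c)
    (hf : ∀ x, f x ∈ Icc c C) (x y : X) :
    Tendsto (fun t => semigroup k t f y - semigroup k t f x) atTop (𝓝 0) := by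
  have hexp : Tendsto (fun t => Real.exp (-(2 * κ * t))) atTop (𝓝 0) :=
    Real.tendsto_exp_neg_atTop_nhds_zero.comp
      (tendsto_id.const_mul_atTop (by positivity : 0 < 2 * κ))
  have edge : ∀ x y, 0 < k x y →
      Tendsto (fun t => semigroup k t f y - semigroup k t f x) atTop (𝓝 0) := by
    intro x y hxy
    rcases eq_or_ne y x with rfl | hne
    · simp
    have hC : 0 < C := hc.trans_le ((hf x).1.trans (hf x).2)
    have hw : 0 < edgeWeight k π (x, y) := by
      simp only [edgeWeight, jumpRate, hne, if_false]
      exact mul_pos (hk.density_pos x) hxy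
    have hsq : Tendsto (fun t => (semigroup k t f y - semigroup k t f x) ^ 2) atTop (𝓝 0) := by
      have hlim := hexp.mul_const
        ((energy k π f fun x => Real.log (f x)) * C / edgeWeight k π (x, y))
      rw [zero_mul] at hlim
      refine squeeze_zero' (Eventually.of_forall fun t => sq_nonneg _) ?_ hlim
      filter_upwards [eventually_ge_atTop 0] with t ht
      have hu := hk.semigroup_mem_Icc hc.le hf ht
      have hpos : ∀ x, 0 < semigroup k t f x := fun x => hc.trans_le (hu x).1
      have h₁ := (hk.summable_energy_of_bounded hM₁ (fun x => abs_le_of_mem_Icc hc (hu x))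
        fun x => abs_log_le_of_mem_Icc hc (hu x)).le_tsum (x, y) fun p _ =>
          mul_nonneg (hk.edgeWeight_nonneg p) (sub_mul_log_sub_log_nonneg (hpos _) (hpos _))
      have h₂ := mul_le_mul_of_nonneg_left (sq_sub_div_le_sub_mul_log_sub_log (hpos x) (hpos y)
        (hu x).2 (hu y).2) hw.le
      have h₃ := h₂.trans (h₁.trans (hk.energy_log_semigroup_le hM₁ hCD hc hf ht))
      calc (semigroup k t f y - semigroup k t f x) ^ 2
          = (edgeWeight k π (x, y) * ((semigroup k t f y - semigroup k t f x) ^ 2 / C)) *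
              (C / edgeWeight k π (x, y)) := by field_simp
        _ ≤ _ := mul_le_mul_of_nonneg_right h₃ (by positivity)
        _ = _ := by ring
    have := hsq.sqrt
    simp only [Real.sqrt_sq_eq_abs, Real.sqrt_zero] at this
    exact (tendsto_zero_iff_abs_tendsto_zero _).2 this
  have h := hk.irreducible x y
  induction h with
  | refl => simp
  | tail _ hyz ih => simpa using ih.add (edge _ _ hyz)

/-- Convergence to equilibrium. -/
theorem tendsto_semigroup (hk : IsReversibleChain k π)
    (hM₁ : Summable fun x => M₁ k x ^ 2 * π x) (hκ : 0 < κ) (hCD : CDUpsilon k κ) (hc : 0 < c)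
    (hf : ∀ x, f x ∈ Icc c C) (x : X) :
    Tendsto (fun t => semigroup k t f x) atTop (𝓝 (∑' y, π y * f y)) := by
  -- By conservation of mass this sum is the mean of `f` minus `P_t f(x)`.
  have hlim : Tendsto (fun t => ∑' y, π y * (semigroup k t f y - semigroup k t f x)) atTop
      (𝓝 (∑' _ : X, (0 : ℝ))) := by
    refine tendsto_tsum_of_dominated_convergence (hk.density_sum.summable.mul_right (C + C))
      (fun y => ?_) ?_
    · simpa using (hk.tendsto_semigroup_sub hM₁ hκ hCD hc hf x y).const_mul (π y)
    · filter_upwards [eventually_ge_atTop 0] with t ht y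
      have hu := hk.semigroup_mem_Icc hc.le hf ht
      rw [norm_mul, Real.norm_of_nonneg (hk.density_pos y).le]
      exact mul_le_mul_of_nonneg_left (abs_sub_le_add_of_le (abs_le_of_mem_Icc hc (hu x))
        (abs_le_of_mem_Icc hc (hu y))) (hk.density_pos y).le
  rw [tsum_zero] at hlim
  have hlim' := (tendsto_const_nhds (x := ∑' y, π y * f y)).sub hlim
  rw [sub_zero] at hlim'
  refine hlim'.congr' ?_
  filter_upwards [eventually_ge_atTop 0] with t ht
  have hu := hk.semigroup_mem_Icc hc.le hf ht
  simp only [mul_sub]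
  rw [(hk.summable_density_mul fun x => abs_le_of_mem_Icc hc (hu x)).tsum_sub
    (hk.density_sum.summable.mul_right _), tsum_mul_right, hk.density_sum.tsum_eq,
    hk.tsum_density_mul_semigroup hM₁ hc hf ht]
  ring

/-- The modified logarithmic Sobolev inequality for functions bounded and bounded away from `0`. -/
theorem tsum_mul_log_le_energy (hk : IsReversibleChain k π)
    (hM₁ : Summable fun x => M₁ k x ^ 2 * π x) (hκ : 0 < κ) (hCD : CDUpsilon k κ) (hc : 0 < c)
    (hf : ∀ x, f x ∈ Icc c C) :
    ∑' x, π x * (f x * Real.log (f x)) ≤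
      (∑' x, π x * f x) * Real.log (∑' x, π x * f x) +
        1 / (4 * κ) * energy k π f fun x => Real.log (f x) := by
  set J := energy k π f fun x => Real.log (f x)
  -- The mass is not normalised, because truncated densities will be inserted; the limiting entropy
  -- is therefore `m log m` instead of `0`.
  set m := ∑' x, π x * f x
  have hJ : 0 ≤ J := hk.energy_log_nonneg fun x => hc.trans_le (hf x).1
  have hm : m ≠ 0 := by
    have hm0 : c ≤ m := by
      have := (hk.density_sum.mul_right c)
      rw [one_mul] at this
      exact hasSum_le (fun x => mul_le_mul_of_nonneg_left (hf x).1 (hk.density_pos x).le) this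
        (hk.summable_density_mul fun x => abs_le_of_mem_Icc hc (hf x)).hasSum
    exact (hc.trans_le hm0).ne'
  have hlim : Tendsto (fun t => ∑' x, π x * (semigroup k t f x * Real.log (semigroup k t f x)))
      atTop (𝓝 (∑' x, π x * (m * Real.log m))) := by
    refine tendsto_tsum_of_dominated_convergence
      (hk.density_sum.summable.mul_right (C * (|Real.log c| + |Real.log C|))) (fun x => ?_) ?_
    · have := hk.tendsto_semigroup hM₁ hκ hCD hc hf x
      exact (this.mul (this.log hm)).const_mul _
    · filter_upwards [eventually_ge_atTop 0] with t ht x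
      rw [norm_mul, Real.norm_of_nonneg (hk.density_pos x).le]
      exact mul_le_mul_of_nonneg_left (abs_mul_log_le_of_mem_Icc hc
        (hk.semigroup_mem_Icc hc.le hf ht x)) (hk.density_pos x).le
  rw [tsum_mul_right, hk.density_sum.tsum_eq, one_mul] at hlim
  -- The derivative of this function is `½ (e^{-2κt} J - energy(P_t f, log P_t f)) ≥ 0`. Comparing
  -- `t = 0` with `t → ∞` replaces an integration of the dissipation over `[0,∞)`; the constant is
  -- `1/(4κ)` since `J = 2ℐ(f)`.
  have hmono := monotoneOn_Ici_of_hasDerivAt_nonneg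
    (F := fun t => ∑' x, π x * (semigroup k t f x * Real.log (semigroup k t f x)) -
      1 / (4 * κ) * J * Real.exp (-(2 * κ * t)))
    ((hk.continuousOn_tsum_mul_log hc hf).sub (by fun_prop))
    (fun t ht => (hk.hasDerivAt_tsum_mul_log hM₁ hc hf ht).sub
      (((hasDerivAt_id t).const_mul (2 * κ)).neg.exp.const_mul (1 / (4 * κ) * J)))
    fun t ht => by
      have := hk.energy_log_semigroup_le hM₁ hCD hc hf ht.le
      have e : 1 / (4 * κ) * J * (Real.exp (-(2 * κ * t)) * -(2 * κ * 1))
          = -(1 / 2) * (Real.exp (-(2 * κ * t)) * J) := by field_simp; ring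
      simp only [id_eq, Pi.neg_apply]
      rw [e]
      linarith
  have hle : ∀ t, 0 ≤ t → ∑' x, π x * (f x * Real.log (f x)) - 1 / (4 * κ) * J ≤
      ∑' x, π x * (semigroup k t f x * Real.log (semigroup k t f x)) := by
    intro t ht
    have := hmono self_mem_Ici ht ht
    simp only [mul_zero, neg_zero, Real.exp_zero, mul_one, hk.semigroup_zero hc.le hf] at this
    have h2 : 0 ≤ 1 / (4 * κ) * J * Real.exp (-(2 * κ * t)) := by positivity
    linarith
  have := ge_of_tendsto hlim (eventually_atTop.2 ⟨0, hle⟩)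
  linarith

/-- Exponential decay of the entropy along the semigroup. -/
theorem tsum_mul_log_semigroup_le (hk : IsReversibleChain k π)
    (hM₁ : Summable fun x => M₁ k x ^ 2 * π x) (hκ : 0 < κ) (hCD : CDUpsilon k κ) (hc : 0 < c)
    (hf : ∀ x, f x ∈ Icc c C) (hm : ∑' x, π x * f x = 1) {t : ℝ} (ht : 0 ≤ t) :
    ∑' x, π x * (semigroup k t f x * Real.log (semigroup k t f x)) ≤
      Real.exp (-(2 * κ * t)) * ∑' x, π x * (f x * Real.log (f x)) := by
  have := le_exp_mul_of_hasDerivAt_le (a := 2 * κ) (hk.continuousOn_tsum_mul_log hc hf)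
    (fun t ht => hk.hasDerivAt_tsum_mul_log hM₁ hc hf ht) (fun t ht => ?_) ht
  · simpa only [hk.semigroup_zero hc.le hf] using this
  -- Applied to `P_t f`, whose mass is `1`, so that `m log m = 0`: the entropy is at most `1/(4κ)`
  -- times the energy, while its derivative is `-½` times the energy.
  · have := hk.tsum_mul_log_le_energy hM₁ hκ hCD hc (hk.semigroup_mem_Icc hc.le hf ht.le)
    rw [hk.tsum_density_mul_semigroup hM₁ hc hf ht.le, hm, Real.log_one, mul_zero, zero_add,
      one_div_mul_eq_div, le_div_iff₀ (by positivity)] at this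
    linarith

end Flow

end IsReversibleChain
end Decay

section Truncation

/-! ### Truncation and the general modified logarithmic Sobolev inequality -/

variable {k : X → X → ℝ} {π : X → ℝ} {f : X → ℝ} {c C : ℝ} {κ : ℝ}

/-- Truncation to the interval `[1/(n+1), n+1]`. -/
noncomputable def clip (n : ℕ) (r : ℝ) : ℝ :=
  max (1 / ((n : ℝ) + 1)) (min r (n + 1))

theorem clip_mem_Icc (n : ℕ) (r : ℝ) : clip n r ∈ Icc (1 / ((n : ℝ) + 1)) (n + 1) := by
  refine ⟨le_max_left _ _, max_le ?_ (min_le_right _ _)⟩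
  have : (0 : ℝ) ≤ n := n.cast_nonneg
  rw [div_le_iff₀ (by positivity)]
  nlinarith

theorem clip_pos (n : ℕ) (r : ℝ) : 0 < clip n r :=
  Nat.one_div_pos_of_nat.trans_le (clip_mem_Icc n r).1

theorem clip_mono (n : ℕ) : Monotone (clip n) := fun _ _ h =>
  max_le_max le_rfl (min_le_min h le_rfl)

theorem clip_sub_clip_le (n : ℕ) {a b : ℝ} (h : a ≤ b) : clip n b - clip n a ≤ b - a := by
  unfold clip
  rcases le_total a ((n : ℝ) + 1) with h₁ | h₁ <;> rcases le_total b ((n : ℝ) + 1) with h₂ | h₂ <;>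
    simp only [min_eq_left, min_eq_right, h₁, h₂] <;>
    rcases max_cases (1 / ((n : ℝ) + 1)) a with h₃ | h₃ <;>
    rcases max_cases (1 / ((n : ℝ) + 1)) b with h₄ | h₄ <;>
    rcases max_cases (1 / ((n : ℝ) + 1)) ((n : ℝ) + 1) with h₅ | h₅ <;> linarith

/-- Equivalently, truncation does not increase the ratio `b/a`. If `a` is not lowered, an increment
of at most `b - a` is added to a base at least `a`; if `a` is lowered, it lies above the upper
level, so does `b`, and the new ratio is `1`. -/
theorem log_clip_sub_log_clip_le (n : ℕ) {a b : ℝ} (ha : 0 < a) (h : a ≤ b) :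
    Real.log (clip n b) - Real.log (clip n a) ≤ Real.log b - Real.log a := by
  rw [← Real.log_div (clip_pos n b).ne' (clip_pos n a).ne',
    ← Real.log_div (ha.trans_le h).ne' ha.ne']
  refine Real.log_le_log (div_pos (clip_pos _ _) (clip_pos _ _)) ?_
  rw [div_le_div_iff₀ (clip_pos _ _) ha]
  have hd := clip_sub_clip_le n h
  have hm := clip_mono n h
  rcases le_or_gt a (clip n a) with h₁ | h₁
  · nlinarith [clip_pos n a]
  · have h₂ : clip n a = max (1 / ((n : ℝ) + 1)) (n + 1) := by
      unfold clip at h₁ ⊢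
      rcases le_total a ((n : ℝ) + 1) with h₃ | h₃
      · rw [min_eq_left h₃] at h₁
        exact absurd (le_max_right _ _) (not_le.2 h₁)
      · rw [min_eq_right h₃]
    have h₃ : clip n b ≤ clip n a := by
      rw [h₂]
      exact max_le_max le_rfl (min_le_right _ _)
    rw [le_antisymm h₃ hm]
    nlinarith [clip_pos n a]

/-- Truncation therefore decreases every term of the Fisher information, which makes lower
semicontinuity arguments unnecessary. -/
theorem clip_sub_mul_log_le (n : ℕ) {a b : ℝ} (ha : 0 < a) (hb : 0 < b) :
    (clip n b - clip n a) * (Real.log (clip n b) - Real.log (clip n a)) ≤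
      (b - a) * (Real.log b - Real.log a) := by
  wlog h : a ≤ b generalizing a b
  · have := this hb ha (le_of_not_ge h)
    linarith
  exact mul_le_mul (clip_sub_clip_le n h) (log_clip_sub_log_clip_le n ha h)
    (sub_nonneg.2 (Real.log_le_log (clip_pos _ _) (clip_mono n h))) (sub_nonneg.2 h)

theorem eventually_clip_eq {r : ℝ} (hr : 0 < r) : ∀ᶠ n in atTop, clip n r = r := by
  have h₁ : ∀ᶠ n : ℕ in atTop, 1 / ((n : ℝ) + 1) < r :=
    tendsto_one_div_add_atTop_nhds_zero_nat.eventually_lt_const hr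
  have h₂ : ∀ᶠ n : ℕ in atTop, r ≤ n := tendsto_natCast_atTop_atTop.eventually_ge_atTop r
  filter_upwards [h₁, h₂] with n h₁ h₂
  rw [clip, min_eq_left (by linarith), max_eq_right h₁.le]

theorem clip_le_add_one (n : ℕ) {r : ℝ} (hr : 0 ≤ r) : clip n r ≤ r + 1 := by
  refine max_le ?_ ((min_le_left _ _).trans (by linarith))
  have : (0 : ℝ) ≤ n := n.cast_nonneg
  rw [div_le_iff₀ (by positivity)]
  nlinarith

theorem abs_mul_log_le_one {r : ℝ} (hr : 0 < r) (hr1 : r ≤ 1) : |r * Real.log r| ≤ 1 := by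
  rw [mul_comm]
  exact (Real.abs_log_mul_self_lt r hr hr1).le

/-- Domination for the entropy limit: below `1`, `|s log s| ≤ 1`; a truncated value above `1` is at
most `r`, and `s log s` increases there. -/
theorem abs_clip_mul_log_le (n : ℕ) {r : ℝ} (hr : 0 < r) :
    |clip n r * Real.log (clip n r)| ≤ |r * Real.log r| + 1 := by
  rcases le_or_gt (clip n r) 1 with h | h
  · linarith [abs_mul_log_le_one (clip_pos n r) h, abs_nonneg (r * Real.log r)]
  · have hle : clip n r ≤ r := by
      rcases max_choice (1 / ((n : ℝ) + 1)) (min r (n + 1)) with h₂ | h₂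
      · rw [clip, h₂, lt_div_iff₀ n.cast_add_one_pos] at h
        linarith [n.cast_nonneg (α := ℝ)]
      · exact h₂.le.trans (min_le_left _ _)
    have h₀ := Real.log_nonneg h.le
    have h₁ := Real.log_le_log (clip_pos n r) hle
    rw [abs_of_nonneg (mul_nonneg (clip_pos n r).le h₀),
      abs_of_nonneg (mul_nonneg hr.le (h₀.trans h₁))]
    linarith [mul_le_mul hle h₁ h₀ hr.le]

/-! ### From truncated to general densities. -/

theorem fisher_term_eq (k : X → X → ℝ) (π f : X → ℝ) (x y : X) :
    k x y * (f y - f x) * (Real.log (f y) - Real.log (f x)) * π x =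
      edgeWeight k π (x, y) * ((f y - f x) * (Real.log (f y) - Real.log (f x))) := by
  rw [edgeWeight, mul_assoc (k x y), jumpRate_mul_of_diag k x y (by rintro rfl; simp)]
  ring

theorem fisher_eq_tsum_edgeWeight (k : X → X → ℝ) (π f : X → ℝ) : fisher k π f =
    2⁻¹ * ∑' p : X × X, ENNReal.ofReal
      (edgeWeight k π p * ((f p.2 - f p.1) * (Real.log (f p.2) - Real.log (f p.1)))) := by
  simp only [fisher, fisher_term_eq]
  rw [ENNReal.tsum_prod']

namespace IsReversibleChain

/-- If `ℐ(f) < ∞`, the Dirichlet energy of any truncation of `f` is at most `2 ℐ(f)`. -/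
theorem energy_clip_le (hk : IsReversibleChain k π) (hM₁ : Summable fun x => M₁ k x ^ 2 * π x)
    (hf : ∀ x, 0 < f x) (hI : fisher k π f ≠ ⊤) (n : ℕ) :
    energy k π (fun x => clip n (f x)) (fun x => Real.log (clip n (f x))) ≤
      2 * (fisher k π f).toReal := by
  have hn : (0 : ℝ) < 1 / ((n : ℝ) + 1) := Nat.one_div_pos_of_nat
  have hS := hk.summable_energy_of_bounded hM₁
    (fun x => abs_le_of_mem_Icc hn (clip_mem_Icc n (f x)))
    (fun x => abs_log_le_of_mem_Icc hn (clip_mem_Icc n (f x)))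
  have hle : ENNReal.ofReal
      (energy k π (fun x => clip n (f x)) (fun x => Real.log (clip n (f x)))) ≤
        2 * fisher k π f := by
    rw [fisher_eq_tsum_edgeWeight, ← mul_assoc,
      ENNReal.mul_inv_cancel two_ne_zero ENNReal.ofNat_ne_top, one_mul, energy,
      ENNReal.ofReal_tsum_of_nonneg (fun p => mul_nonneg (hk.edgeWeight_nonneg p)
        (sub_mul_log_sub_log_nonneg (clip_pos _ _) (clip_pos _ _))) hS]
    exact ENNReal.tsum_le_tsum fun p => ENNReal.ofReal_le_ofReal
      (mul_le_mul_of_nonneg_left (clip_sub_mul_log_le n (hf _) (hf _)) (hk.edgeWeight_nonneg p))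
  have := (ENNReal.ofReal_le_iff_le_toReal (ENNReal.mul_ne_top ENNReal.ofNat_ne_top hI)).1 hle
  simpa using this

/-- Apply the bounded case to the truncations. Masses and entropies converge by domination, so the
correction `m log m` tends to `1 · log 1 = 0`, and the energies need only the uniform bound `2ℐ(f)`.
-/
theorem tsum_mul_log_le_fisher [Countable X] (hk : IsReversibleChain k π)
    (hM₁ : Summable fun x => M₁ k x ^ 2 * π x) (hκ : 0 < κ) (hCD : CDUpsilon k κ)
    (hf : IsPosDensity π f) (hH : Summable fun x => f x * Real.log (f x) * π x)
    (hI : fisher k π f ≠ ⊤) :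
    ∑' x, f x * Real.log (f x) * π x ≤ 1 / (2 * κ) * (fisher k π f).toReal := by
  obtain ⟨hpos, hmass⟩ := hf
  have hm : Tendsto (fun n => ∑' x, π x * clip n (f x)) atTop (𝓝 1) := by
    rw [← hmass.tsum_eq]
    refine tendsto_tsum_of_dominated_convergence (hmass.summable.add hk.density_sum.summable)
      (fun x => ?_) (Eventually.of_forall fun n x => ?_)
    · refine tendsto_const_nhds.congr' ?_
      filter_upwards [eventually_clip_eq (hpos x)] with n hn
      rw [hn, mul_comm]
    · rw [norm_mul, Real.norm_of_nonneg (hk.density_pos x).le,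
        Real.norm_of_nonneg (clip_pos _ _).le]
      nlinarith [clip_le_add_one n (hpos x).le, hk.density_pos x]
  have hE : Tendsto (fun n => ∑' x, π x * (clip n (f x) * Real.log (clip n (f x)))) atTop
      (𝓝 (∑' x, f x * Real.log (f x) * π x)) := by
    refine tendsto_tsum_of_dominated_convergence (hH.abs.add hk.density_sum.summable)
      (fun x => ?_) (Eventually.of_forall fun n x => ?_)
    · refine tendsto_const_nhds.congr' ?_
      filter_upwards [eventually_clip_eq (hpos x)] with n hn
      rw [hn, mul_comm]
    · rw [norm_mul, Real.norm_of_nonneg (hk.density_pos x).le, abs_mul _ (π x),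
        abs_of_pos (hk.density_pos x), Real.norm_eq_abs]
      nlinarith [abs_clip_mul_log_le n (hpos x), hk.density_pos x]
  have hlim := (hm.mul (hm.log one_ne_zero)).add_const (1 / (2 * κ) * (fisher k π f).toReal)
  rw [Real.log_one, mul_zero, zero_add] at hlim
  refine le_of_tendsto_of_tendsto' hE hlim fun n => ?_
  refine (hk.tsum_mul_log_le_energy hM₁ hκ hCD Nat.one_div_pos_of_nat
    fun x => clip_mem_Icc n (f x)).trans ?_
  have := mul_le_mul_of_nonneg_left (hk.energy_clip_le hM₁ hpos hI n)
    (by positivity : 0 ≤ 1 / (4 * κ))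
  have e : 1 / (4 * κ) * (2 * (fisher k π f).toReal) = 1 / (2 * κ) * (fisher k π f).toReal := by
    field_simp
    ring
  linarith

theorem mlsi [Countable X] (hk : IsReversibleChain k π)
    (hM₁ : Summable fun x => M₁ k x ^ 2 * π x) (hκ : 0 < κ) (hCD : CDUpsilon k κ) :
    MLSI k π κ := by
  intro f hf hH
  have hS : Summable fun x => f x * Real.log (f x) * π x := by
    by_contra h
    simp [entropy, h] at hH
  rcases eq_or_ne (fisher k π f) ⊤ with hI | hI
  -- For infinite Fisher information the right side is `⊤`, as the factor `1/(2κ)` is positive.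
  · rw [hI, EReal.coe_ennreal_top, EReal.coe_mul_top_of_pos (by positivity)]
    exact le_top
  · rw [entropy, if_pos hS, ← EReal.coe_ennreal_toReal hI, ← EReal.coe_mul, EReal.coe_le_coe_iff]
    exact hk.tsum_mul_log_le_fisher hM₁ hκ hCD hf hS hI

theorem entropy_eq_of_mem_Icc (hk : IsReversibleChain k π) (hc : 0 < c)
    (hf : ∀ x, f x ∈ Icc c C) :
    entropy π f = ((∑' x, π x * (f x * Real.log (f x)) : ℝ) : EReal) := by
  have hS := hk.summable_density_mul fun x => abs_mul_log_le_of_mem_Icc hc (hf x)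
  simp only [mul_comm (π _)] at hS ⊢
  rw [entropy, if_pos hS]

theorem entropy_semigroup_le [Countable X] (hk : IsReversibleChain k π)
    (hM₁ : Summable fun x => M₁ k x ^ 2 * π x) (hκ : 0 < κ) (hCD : CDUpsilon k κ)
    (hf : IsPosBddDensity π f) {t : ℝ} (ht : 0 ≤ t) :
    entropy π (semigroup k t f) ≤ ((Real.exp (-2 * κ * t) : ℝ) : EReal) * entropy π f := by
  obtain ⟨⟨-, hmass⟩, hbdd, c, hc, hcf⟩ := hf
  obtain ⟨C, hC⟩ := memℓp_infty_iff.1 hbdd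
  have hf' : ∀ x, f x ∈ Icc c C := fun x => ⟨hcf x, (le_abs_self _).trans (hC ⟨x, rfl⟩)⟩
  have hm : ∑' x, π x * f x = 1 := by
    simp only [mul_comm (π _)]
    exact hmass.tsum_eq
  rw [hk.entropy_eq_of_mem_Icc hc hf', hk.entropy_eq_of_mem_Icc hc
    (hk.semigroup_mem_Icc hc.le hf' ht), ← EReal.coe_mul, EReal.coe_le_coe_iff]
  have := hk.tsum_mul_log_semigroup_le hM₁ hκ hCD hc hf' hm ht
  rwa [neg_mul, neg_mul]

end IsReversibleChain
end Truncation

end MarkovChainCD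

theorem corollary3p6 {X : Type*} [Countable X] (k : X → X → ℝ) (π : X → ℝ)
    (hchain : MarkovChainCD.IsReversibleChain k π)
    (hM₁ : Summable fun x => MarkovChainCD.M₁ k x ^ 2 * π x)
    (hM₂ : Summable fun x => MarkovChainCD.M₂ k x * π x)
    (κ : ℝ) (hκ : 0 < κ) (hCD : MarkovChainCD.CDUpsilon k κ) :
    MarkovChainCD.MLSI k π κ ∧
      ∀ f : X → ℝ, MarkovChainCD.IsPosBddDensity π f → ∀ t : ℝ, 0 ≤ t →
        MarkovChainCD.entropy π (MarkovChainCD.semigroup k t f) ≤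
          ((Real.exp (-2 * κ * t) : ℝ) : EReal) * MarkovChainCD.entropy π f :=
  ⟨hchain.mlsi hM₁ hκ hCD, fun _ hf _ ht => hchain.entropy_semigroup_le hM₁ hκ hCD hf ht⟩
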